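/- Let $1\le k\le n$. For $m\ge 1$ let $\mathcal X_m$ be the set of complex $n\times m$ matrices $X$ with $X^*X=I_m$, and for an $m\times m$ complex matrix $B$ let $F(B)=\{x^*Bx : x\in\mathbb C^m,\ x^*x=1\}$ be its numerical range. For a complex $n\times n$ matrix $A$ let $$\Lambda_k(A)=\{\lambda\in\mathbb C : X^*AX=\lambda I_k \text{ for some } X\in\mathcal X_k\},\qquad \widetilde r_k(A)=\min\{|z| : z\in\partial\Lambda_k(A)\}$$ be its $k$-rank numerical range and its inner $k$-rank numerical radius; minima, infima and suprema of moduli are taken in $[0,\infty]$, with $\min\emptyset=\inf\emptyset=\infty$. For a sequence $(M_p)_{p\ge1}$ in $\mathcal X_{n-k+1}$ put $\mathcal J_\nu(A)=\bigcap_{p=1}^{\nu}F(M_p^*AM_p)$, $\nu\ge1$. There is a sequence that is dense in $\mathcal X_{n-k+1}$. Moreover, let $(M_p)$ be a sequence in $\mathcal X_{n-k+1}$ and $A$ a complex $n\times n$ matrix such that $(M_p)$ is dense in $\mathcal X_{n-k+1}$ or $\Lambda_k(A)=\bigcap_{p\ge1}F(M_p^*AM_p)$. If $0\notin\Lambda_k(A)$,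 then $$\widetilde r_k(A)=\lim_{\nu\to\infty}\inf\{|z| : z\in\mathcal J_\nu(A)\}=\sup_{\nu\ge1}\,\inf\{|z| : z\in\mathcal J_\nu(A)\},$$ and the minimum defining $\widetilde r_k(A)$ is attained whenever $\Lambda_k(A)\neq\emptyset$. In particular, there is a sequence $(M_p)$ in $\mathcal X_{n-k+1}$, independent of $A$, for which these equalities hold for every $A$ with $0\notin\Lambda_k(A)$. -/

import Mathlib

open scoped Matrix ENNReal

/-- The set `𝒳_m` of `n × m` complex isometries: matrices `X` with `X* X = I_m`. -/
def isometries (n m : ℕ) : Set (Matrix (Fin n) (Fin m) ℂ) :=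
  {X | Xᴴ * X = 1}

/-- The numerical range `F(B) = {x* B x : x* x = 1}`. -/
def numRange {m : ℕ} (B : Matrix (Fin m) (Fin m) ℂ) : Set ℂ :=
  {z | ∃ x : Fin m → ℂ, star x ⬝ᵥ x = 1 ∧ star x ⬝ᵥ (B *ᵥ x) = z}

/-- The `k`-rank numerical range
`Λ_k(A) = {z : X* A X = z I_k for some n × k isometry X}`. -/
def rankNumRange (k : ℕ) {n : ℕ} (A : Matrix (Fin n) (Fin n) ℂ) : Set ℂ :=
  {z | ∃ X ∈ isometries n k, Xᴴ * A * X = z • (1 : Matrix (Fin k) (Fin k) ℂ)}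

/-- The least modulus of the points of a set of complex numbers, as an element of `[0, ∞]`:
`inf {|z| : z ∈ S}`, which is `∞` exactly when `S` is empty. -/
noncomputable def infModulus (S : Set ℂ) : ℝ≥0∞ :=
  ⨅ z ∈ S, ‖z‖ₑ

/-- The inner `k`-rank numerical radius: the least modulus on the boundary of `Λ_k(A)`. -/
noncomputable def innerRankRadius (k : ℕ) {n : ℕ} (A : Matrix (Fin n) (Fin n) ℂ) : ℝ≥0∞ :=
  infModulus (frontier (rankNumRange k A))

/-- `𝒥_ν(A)`, the intersection of the numerical ranges `F(M_p* A M_p)` over the members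
`M_0, …, M_ν` of a sequence of isometries (the sequence is numbered from `0`, so that
`ν = 0` gives the first numerical range). -/
def interRange {n m : ℕ} (M : ℕ → isometries n m) (A : Matrix (Fin n) (Fin n) ℂ) (ν : ℕ) :
    Set ℂ :=
  ⋂ p ≤ ν, numRange ((M p : Matrix (Fin n) (Fin m) ℂ)ᴴ * A * (M p : Matrix (Fin n) (Fin m) ℂ))

/-! The core is the identity Λ_k(A) = ⋂ F(M*AM), with M running over all n × (n-k+1) isometries. One
inclusion is a dimension count. For the other, let μ lie in every F(M*AM) and put T = A - μ. Then
for no c ≠ 0 is the real part of cT negative definite on a subspace of dimension n-k+1.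
`NegIndexLE.hasIsotropic` converts this into a totally isotropic subspace of dimension at least k,
and k orthonormal vectors in it are the columns of X.

That lemma is an induction on dimension. If there is an isotropic x ≠ 0 with Tx and T*x on one line,
it is split off (`HasIsotropic.of_isotropic_vector`). Otherwise the form is diagonal in some basis,
no two diagonal values point in opposite directions, and `HasIsotropic.of_orthogonal_basis` finds a
hyperplane on which the index bound drops by one for all c simultaneously. Its coefficients come
from a rational function with prescribed residue signs and as few zeros as possible
(`exists_pos_weights_sum_div_sign`).

Since μ ∈ F(M*AM) is a closed condition on M, a dense sequence suffices. Thus Λ_k(A) is a decreasing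
intersection of the compact sets 𝒥_ν, so its least modulus is the supremum of theirs; as 0 ∉ Λ_k(A),
a point of least modulus lies on the boundary. -/

/-! ### Rational functions with prescribed residue signs -/

/-- The sum R(τ) has simple poles at S with residues of sign ε, so it must vanish between
neighbouring poles of equal sign. The weights are built, adding poles from left to right, so that R
has one zero in each such gap and no others. The conditions on τ single out the remaining gaps and
the two unbounded intervals, where a missing neighbour imposes nothing. -/
theorem exists_pos_weights_sum_div_sign (ε : ℝ → ℝ) (S : Finset ℝ)
    (hε : ∀ a ∈ S, ε a = 1 ∨ ε a = -1) :
    S.Nonempty → ∃ w : ℝ → ℝ, (∀ a ∈ S, 0 < w a) ∧ ∀ τ ∉ S, ∀ σ : ℝ, (σ = 1 ∨ σ = -1) →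
      (∀ a ∈ S, a < τ → (∀ b ∈ S, b < τ → b ≤ a) → ε a = -σ) →
      (∀ a ∈ S, τ < a → (∀ b ∈ S, τ < b → a ≤ b) → ε a = σ) →
      σ * ∑ a ∈ S, w a * ε a / (τ - a) < 0 := by
  induction S using Finset.induction_on_max with
  | empty => simp
  | insert b S hb ih =>
    intro _
    have hbS : b ∉ S := fun h => lt_irrefl _ (hb b h)
    have hεb := hε b (Finset.mem_insert_self b S)
    rcases S.eq_empty_or_nonempty with rfl | hS
    · refine ⟨fun _ => 1, by simp, ?_⟩
      intro τ hτ σ hσ h1 h2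
      have hτ' : τ ≠ b := by simpa using hτ
      simp only [insert_empty_eq, Finset.sum_singleton]
      rcases lt_or_gt_of_ne hτ' with h | h
      · have e := h2 b (by simp) h (by simp)
        rw [e, one_mul, mul_div_assoc']
        have : σ * σ = 1 := by rcases hσ with rfl | rfl <;> norm_num
        rw [this]
        exact div_neg_of_pos_of_neg one_pos (by linarith)
      · have e := h1 b (by simp) h (by simp)
        rw [e, one_mul, mul_div_assoc']
        have : σ * -σ = -1 := by rcases hσ with rfl | rfl <;> norm_num
        rw [this]
        exact div_neg_of_neg_of_pos (by norm_num) (by linarith)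
    · obtain ⟨w, hw, hR⟩ := ih (fun a ha => hε a (Finset.mem_insert_of_mem ha)) hS
      set a0 := S.max' hS with ha0
      have ha0S : a0 ∈ S := S.max'_mem hS
      have hle : ∀ a ∈ S, a ≤ a0 := fun a ha => S.le_max' a ha
      have hεa0 := hε a0 (Finset.mem_insert_of_mem ha0S)
      have ha0b := hb a0 ha0S
      set R : ℝ → ℝ := fun τ => ∑ a ∈ S, w a * ε a / (τ - a) with hRdef
      -- Right of all poles only the left neighbour a0 counts, which admits σ = -ε a0. At τ = b this
      -- fixes the sign of the new residue.
      have hlast : ∀ τ, a0 < τ → 0 < ε a0 * R τ := by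
        intro τ hτ
        have := hR τ (fun h => absurd (hle τ h) (not_le.2 hτ)) (-ε a0)
          (by rcases hεa0 with h | h <;> simp [h])
          (fun a ha _ hmax => by
            have : a = a0 := le_antisymm (hle a ha) (hmax a0 ha0S hτ)
            rw [this]; ring)
          (fun a ha hlt _ => absurd (hle a ha) (not_le.2 (hτ.trans hlt)))
        have h' : -ε a0 * R τ < 0 := this
        linarith
      by_cases hsame : ε b = ε a0
      -- Equal signs: multiply R by (τ - m)/(τ - b), which adds the pole b and a zero m in the new
      -- gap. The weights are the residues times their signs.
      · obtain ⟨m, hm1, hm2⟩ := exists_between ha0b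
        refine ⟨fun a => if a = b then ε a0 * R b * (b - m) else w a * ((m - a) / (b - a)),
          ?_, ?_⟩
        · intro a ha
          rcases Finset.mem_insert.1 ha with rfl | ha
          · simp only [if_true]
            exact mul_pos (hlast a ha0b) (by linarith)
          · simp only [if_neg (fun h : a = b => hbS (h ▸ ha))]
            have := hle a ha
            exact mul_pos (hw a ha) (div_pos (by linarith) (by linarith))
        · intro τ hτ σ hσ h1 h2
          have hτb : τ ≠ b := fun h => hτ (by simp [h])
          have hτS : τ ∉ S := fun h => hτ (by simp [h])
          have hsum : ∑ a ∈ insert b S, (if a = b then ε a0 * R b * (b - m)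
              else w a * ((m - a) / (b - a))) * ε a / (τ - a) = R τ * ((τ - m) / (τ - b)) := by
            rw [Finset.sum_insert hbS, if_pos rfl, hsame]
            have e1 : ε a0 * R b * (b - m) * ε a0 = R b * (b - m) := by
              rcases hεa0 with h | h <;> rw [h] <;> ring
            rw [e1, hRdef]
            simp only
            rw [Finset.sum_mul, Finset.sum_mul, Finset.sum_div, ← Finset.sum_add_distrib]
            refine Finset.sum_congr rfl fun a ha => ?_
            have hab : a ≠ b := fun h => hbS (h ▸ ha)
            have hτa : τ ≠ a := fun h => hτS (h ▸ ha)
            rw [if_neg hab]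
            have n1 : b - a ≠ 0 := sub_ne_zero.2 hab.symm
            have n2 : τ - a ≠ 0 := sub_ne_zero.2 hτa
            have n3 : τ - b ≠ 0 := sub_ne_zero.2 hτb
            field_simp
            ring
          rw [hsum]
          rcases lt_or_gt_of_ne hτb with hlt | hgt
          -- The gap (a0, b) is excluded because its end signs agree; hence also τ < m.
          · have hτ0 : τ < a0 := by
              by_contra hcon
              have h0τ : a0 < τ := lt_of_le_of_ne (not_lt.1 hcon) (fun h => hτS (h ▸ ha0S))
              have e1 := h2 b (by simp) hlt (fun c hc hτc => by
                rcases Finset.mem_insert.1 hc with rfl | hc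
                · exact le_rfl
                · exact absurd (hle c hc) (not_le.2 (h0τ.trans hτc)))
              have e2 := h1 a0 (by simp [ha0S]) h0τ (fun c hc hcτ => by
                rcases Finset.mem_insert.1 hc with rfl | hc
                · exact absurd hlt (not_lt.2 hcτ.le)
                · exact hle c hc)
              rw [e1, e2] at hsame
              rcases hσ with rfl | rfl <;> norm_num at hsame
            have := hR τ hτS σ hσ
              (fun a ha haτ hmax => h1 a (by simp [ha]) haτ (fun c hc hcτ => by
                rcases Finset.mem_insert.1 hc with rfl | hc
                · exact absurd hlt (not_lt.2 hcτ.le)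
                · exact hmax c hc hcτ))
              (fun a ha haτ hmin => h2 a (by simp [ha]) haτ (fun c hc hcτ => by
                rcases Finset.mem_insert.1 hc with rfl | hc
                · exact (hb a ha).le
                · exact hmin c hc hcτ))
            rw [← mul_assoc]
            exact mul_neg_of_neg_of_pos this
              (div_pos_of_neg_of_neg (by linarith) (by linarith))
          · have e := h1 b (by simp) hgt (fun c hc _ => by
              rcases Finset.mem_insert.1 hc with rfl | hc
              · exact le_rfl
              · exact (hb c hc).le)
            have hl := hlast τ (ha0b.trans hgt)
            have hσ' : σ = -ε a0 := by rw [← hsame, e]; ring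
            rw [hσ', ← mul_assoc]
            exact mul_neg_of_neg_of_pos (by linarith) (div_pos (by linarith) (by linarith))
      · have hdiff : ε b = -ε a0 := by
          rcases hεb with h | h <;> rcases hεa0 with h' | h' <;> rw [h, h'] at hsame ⊢ <;>
            first | exact absurd rfl hsame | norm_num
        -- Opposite signs: multiply R by 1/(b - τ), a new pole without a new zero.
        refine ⟨fun a => if a = b then ε a0 * R b else w a / (b - a), ?_, ?_⟩
        · intro a ha
          rcases Finset.mem_insert.1 ha with rfl | ha
          · simp only [if_true]
            exact hlast a ha0b
          · simp only [if_neg (fun h : a = b => hbS (h ▸ ha))]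
            exact div_pos (hw a ha) (by linarith [hb a ha])
        · intro τ hτ σ hσ h1 h2
          have hτb : τ ≠ b := fun h => hτ (by simp [h])
          have hτS : τ ∉ S := fun h => hτ (by simp [h])
          have hsum : ∑ a ∈ insert b S, (if a = b then ε a0 * R b
              else w a / (b - a)) * ε a / (τ - a) = R τ * (1 / (b - τ)) := by
            rw [Finset.sum_insert hbS, if_pos rfl, hdiff]
            have e1 : ε a0 * R b * -ε a0 = R b * (-1) := by
              rcases hεa0 with h | h <;> rw [h] <;> ring
            rw [e1, hRdef]
            simp only
            rw [Finset.sum_mul, Finset.sum_mul, Finset.sum_div, ← Finset.sum_add_distrib]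
            refine Finset.sum_congr rfl fun a ha => ?_
            have hab : a ≠ b := fun h => hbS (h ▸ ha)
            have hτa : τ ≠ a := fun h => hτS (h ▸ ha)
            rw [if_neg hab]
            have n1 : b - a ≠ 0 := sub_ne_zero.2 hab.symm
            have n2 : τ - a ≠ 0 := sub_ne_zero.2 hτa
            have n3 : τ - b ≠ 0 := sub_ne_zero.2 hτb
            have n4 : b - τ ≠ 0 := sub_ne_zero.2 hτb.symm
            field_simp
            ring
          rw [hsum]
          rcases lt_or_gt_of_ne hτb with hlt | hgt
          · have key : σ * R τ < 0 := by
              by_cases hτ0 : τ < a0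
              · exact hR τ hτS σ hσ
                  (fun a ha haτ hmax => h1 a (by simp [ha]) haτ (fun c hc hcτ => by
                    rcases Finset.mem_insert.1 hc with rfl | hc
                    · exact absurd hlt (not_lt.2 hcτ.le)
                    · exact hmax c hc hcτ))
                  (fun a ha haτ hmin => h2 a (by simp [ha]) haτ (fun c hc hcτ => by
                    rcases Finset.mem_insert.1 hc with rfl | hc
                    · exact (hb a ha).le
                    · exact hmin c hc hcτ))
              · have h0τ : a0 < τ := lt_of_le_of_ne (not_lt.1 hτ0) (fun h => hτS (h ▸ ha0S))
                have e2 := h1 a0 (by simp [ha0S]) h0τ (fun c hc hcτ => by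
                  rcases Finset.mem_insert.1 hc with rfl | hc
                  · exact absurd hlt (not_lt.2 hcτ.le)
                  · exact hle c hc)
                have hl := hlast τ h0τ
                rw [e2] at hl
                linarith
            rw [← mul_assoc]
            exact mul_neg_of_neg_of_pos key (div_pos one_pos (by linarith))
          · have e := h1 b (by simp) hgt (fun c hc _ => by
              rcases Finset.mem_insert.1 hc with rfl | hc
              · exact le_rfl
              · exact (hb c hc).le)
            have hl := hlast τ (ha0b.trans hgt)
            have hσ' : σ = ε a0 := by linarith [hdiff, e]
            rw [hσ', ← mul_assoc]
            exact mul_neg_of_pos_of_neg hl (div_neg_of_pos_of_neg one_pos (by linarith))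

/-! ### Positive weights for finitely many complex numbers -/

open Filter Topology in
theorem eventually_re_mul_one_add_mul_I_ne_zero {u : ℂ} (hu : u ≠ 0) :
    ∀ᶠ δ : ℝ in 𝓝[>] 0, (u * (1 + δ * Complex.I)).re ≠ 0 := by
  have hre : ∀ δ : ℝ, (u * (1 + δ * Complex.I)).re = u.re - δ * u.im := by
    intro δ; simp; ring
  simp only [hre]
  by_cases h : u.re = 0
  · have him : u.im ≠ 0 := fun h' => hu (Complex.ext h h')
    filter_upwards [self_mem_nhdsWithin] with δ hδ
    rw [h, zero_sub, neg_ne_zero]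
    exact mul_ne_zero (ne_of_gt hδ) him
  · have : Tendsto (fun δ : ℝ => u.re - δ * u.im) (𝓝[>] 0) (𝓝 (u.re - 0 * u.im)) :=
      (Continuous.tendsto (by fun_prop) 0).mono_left nhdsWithin_le_nhds
    exact this.eventually_ne (by simpa using h)

open Filter Topology in
theorem Finset.exists_lt_forall_lt_of_lt (S : Finset ℝ) (a : ℝ) :
    ∃ t < a, ∀ b ∈ S, b < a → b < t := by
  have h : ∀ᶠ t in 𝓝[<] a, ∀ b ∈ S, b < a → b < t := by
    rw [Filter.eventually_all_finset]
    intro b _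
    by_cases hba : b < a
    · filter_upwards [Ioo_mem_nhdsLT hba] with t ht _ using ht.1
    · exact Eventually.of_forall fun t h => absurd h hba
  obtain ⟨t, ht, hta⟩ := (h.and self_mem_nhdsWithin).exists
  exact ⟨t, hta, ht⟩

open Filter Topology in
theorem Finset.exists_gt_forall_lt_of_gt (S : Finset ℝ) (a : ℝ) :
    ∃ t > a, ∀ b ∈ S, a < b → t < b := by
  have h : ∀ᶠ t in 𝓝[>] a, ∀ b ∈ S, a < b → t < b := by
    rw [Filter.eventually_all_finset]
    intro b _
    by_cases hba : a < b
    · filter_upwards [Ioo_mem_nhdsGT hba] with t ht _ using ht.2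
    · exact Eventually.of_forall fun t h => absurd h hba
  obtain ⟨t, ht, hta⟩ := (h.and self_mem_nhdsWithin).exists
  exact ⟨t, hta, ht⟩

/-- With s = Im z / Re z and τ = Re c / Im c one has Re(cz) = Re z · Im c · (τ - s), so the sum
becomes a partial fraction in τ with poles s i. When the count attains its bound r, the signs at the
poles next to τ are forced: otherwise crossing such a pole would gain negative terms and lose none.
`hanti` makes the sign depend on s alone. -/
theorem exists_pos_weights_of_re_ne_zero {ι : Type*} [Fintype ι] [Nonempty ι] (z : ι → ℂ)
    (hz : ∀ i, (z i).re ≠ 0) (hanti : ∀ i j (t : ℝ), 0 < t → z j ≠ -(t : ℂ) * z i) (r : ℕ)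
    (hN : ∀ c : ℂ, c ≠ 0 → (Finset.univ.filter fun i => (c * z i).re < 0).card ≤ r) :
    ∃ ω : ι → ℝ, (∀ i, 0 < ω i) ∧ ∀ c : ℂ, c.im ≠ 0 → (∀ i, (c * z i).re ≠ 0) →
      (Finset.univ.filter fun i => (c * z i).re < 0).card = r →
      ∑ i, ω i / (c * z i).re < 0 := by
  classical
  set s : ι → ℝ := fun i => (z i).im / (z i).re with hs
  set ε : ℝ → ℝ := fun a => if ∃ i, s i = a ∧ 0 < (z i).re then 1 else -1 with hε
  have hmul : ∀ (c : ℂ) i, (c * z i).re = (z i).re * (c.re - c.im * s i) := by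
    intro c i
    rw [Complex.mul_re, hs]
    have := hz i
    field_simp
  have hεi : ∀ i, (z i).re = |(z i).re| * ε (s i) := by
    intro i
    rcases lt_or_gt_of_ne (hz i) with h | h
    · have : ¬ ∃ j, s j = s i ∧ 0 < (z j).re := by
        rintro ⟨j, hj, hpos⟩
        refine hanti i j (-((z j).re / (z i).re)) ?_ ?_
        · exact neg_pos.2 (div_neg_of_pos_of_neg hpos h)
        · have h1 := hz i
          have h2 := hz j
          simp only [hs] at hj
          rw [div_eq_div_iff h2 h1] at hj
          apply Complex.ext
          · simp only [Complex.ofReal_neg, neg_neg, Complex.re_ofReal_mul]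
            field_simp
          · simp only [Complex.ofReal_neg, neg_neg, Complex.im_ofReal_mul]
            field_simp
            linarith
      simp only [hε, if_neg this, abs_of_neg h]
      ring
    · have : ∃ j, s j = s i ∧ 0 < (z j).re := ⟨i, rfl, h⟩
      simp only [hε, if_pos this, abs_of_pos h, mul_one]
  have hε1 : ∀ a, ε a = 1 ∨ ε a = -1 := by
    intro a
    simp only [hε]
    split_ifs <;> simp
  set S := Finset.univ.image s with hS
  have hsS : ∀ i, s i ∈ S := fun i => Finset.mem_image_of_mem s (Finset.mem_univ i)
  obtain ⟨w, hw, hR⟩ := exists_pos_weights_sum_div_sign ε S (fun a _ => hε1 a)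
    (Finset.univ_nonempty.image s)
  -- Indices with equal s share a pole; dividing by the multiplicity makes their contributions add
  -- up to the weight `w a`.
  set m : ℝ → ℝ := fun a => ((Finset.univ.filter fun i => s i = a).card : ℝ) with hm
  have hmpos : ∀ a ∈ S, 0 < m a := by
    intro a ha
    obtain ⟨i, _, rfl⟩ := Finset.mem_image.1 ha
    exact Nat.cast_pos.2 (Finset.card_pos.2 ⟨i, by simp⟩)
  refine ⟨fun i => w (s i) * |(z i).re| / m (s i), fun i => ?_, ?_⟩
  · exact div_pos (mul_pos (hw _ (hsS i)) (abs_pos.2 (hz i))) (hmpos _ (hsS i))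
  intro c hc hgen hcard
  set τ := c.re / c.im with hτ
  have hcτ : ∀ a, c.re - c.im * a = c.im * (τ - a) := by
    intro a; rw [hτ]; field_simp
  have hτs : ∀ i, τ - s i ≠ 0 := by
    intro i h
    apply hgen i
    rw [hmul, hcτ, h]; ring
  have hτS : τ ∉ S := by
    intro h
    obtain ⟨i, _, hi⟩ := Finset.mem_image.1 h
    exact hτs i (by rw [hi]; ring)
  have hsum : ∑ i, w (s i) * |(z i).re| / m (s i) / (c * z i).re =
      (∑ a ∈ S, w a * ε a / (τ - a)) / c.im := by
    have h1 : ∀ i, w (s i) * |(z i).re| / m (s i) / (c * z i).re =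
        (fun a => w a * ε a / (τ - a) / c.im / m a) (s i) := by
      intro i
      simp only
      rw [hmul, hcτ]
      have e1 := hτs i
      have e2 := (hmpos _ (hsS i)).ne'
      have e3 := abs_ne_zero.2 (hz i)
      have e4 : ε (s i) ≠ 0 := by rcases hε1 (s i) with h | h <;> rw [h] <;> norm_num
      have e5 : ε (s i) * ε (s i) = 1 := by rcases hε1 (s i) with h | h <;> rw [h] <;> norm_num
      conv_lhs => rw [hεi i, abs_mul, abs_abs]
      have e6 : |ε (s i)| = 1 := by rcases hε1 (s i) with h | h <;> rw [h] <;> norm_num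
      rw [e6]
      field_simp
      linear_combination (-w (s i)) * e5
    rw [Finset.sum_congr rfl fun i _ => h1 i,
      Finset.sum_comp (fun a => w a * ε a / (τ - a) / c.im / m a) s, Finset.sum_div]
    refine Finset.sum_congr rfl fun a ha => ?_
    have e2 := (hmpos a ha).ne'
    rw [nsmul_eq_mul]
    exact mul_div_cancel₀ _ e2
  rw [hsum]
  have main : ∀ σ : ℝ, (σ = 1 ∨ σ = -1) → 0 < σ * c.im →
      σ * (∑ a ∈ S, w a * ε a / (τ - a)) < 0 := by
    intro σ hσ hσc
    have hσσ : σ * σ = 1 := by rcases hσ with h | h <;> rw [h] <;> norm_num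
    have hmem : ∀ i, (c * z i).re < 0 ↔ ε (s i) * σ * (τ - s i) < 0 := by
      intro i
      have e1 : (c * z i).re = (|(z i).re| * (σ * c.im)) * (ε (s i) * σ * (τ - s i)) := by
        rw [hmul, hcτ]
        conv_lhs => rw [hεi i]
        linear_combination (-(|(z i).re| * c.im * (τ - s i) * ε (s i))) * hσσ
      rw [e1]
      have := mul_pos (abs_pos.2 (hz i)) hσc
      exact ⟨fun h => by by_contra hh; exact absurd h (not_lt.2 (mul_nonneg this.le (not_lt.1 hh))),
        fun h => mul_neg_of_pos_of_neg this h⟩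
    have hle : ∀ t : ℝ, (Finset.univ.filter fun i => ε (s i) * σ * (t - s i) < 0).card ≤ r := by
      intro t
      have hne : (σ : ℂ) * (t + Complex.I) ≠ 0 := by
        intro h
        have := congrArg Complex.im h
        simp at this
        rw [this] at hσσ; norm_num at hσσ
      refine le_trans (le_of_eq ?_) (hN _ hne)
      congr 1
      ext i
      simp only [Finset.mem_filter, Finset.mem_univ, true_and]
      have e1 : ((σ : ℂ) * (t + Complex.I) * z i).re =
          |(z i).re| * (ε (s i) * σ * (t - s i)) := by
        rw [hmul]
        conv_lhs => rw [hεi i]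
        simp
        ring
      rw [e1]
      have := abs_pos.2 (hz i)
      exact ⟨fun h => mul_neg_of_pos_of_neg this h,
        fun h => by by_contra hh; exact absurd h (not_lt.2 (mul_nonneg this.le (not_lt.1 hh)))⟩
    -- Between τ and t only the pole `s i₀` is crossed, and its positive terms turn negative,
    -- pushing the count above r.
    have hcross : ∀ (t : ℝ) (i₀ : ι), ε (s i₀) * σ * (t - s i₀) < 0 →
        0 < ε (s i₀) * σ * (τ - s i₀) →
        (∀ i, s i ≠ s i₀ → 0 < (t - s i) * (τ - s i)) → False := by
      intro t i₀ h1 h2 h3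
      have hss : (Finset.univ.filter fun i => (c * z i).re < 0) ⊂
          (Finset.univ.filter fun i => ε (s i) * σ * (t - s i) < 0) := by
        rw [Finset.ssubset_iff_of_subset]
        · refine ⟨i₀, by simpa using h1, ?_⟩
          simp only [Finset.mem_filter, Finset.mem_univ, true_and, hmem]
          exact not_lt.2 h2.le
        · intro i
          simp only [Finset.mem_filter, Finset.mem_univ, true_and, hmem]
          intro hi
          by_cases hii : s i = s i₀
          · rw [hii] at hi
            exact absurd hi (not_lt.2 h2.le)
          · have h4 := h3 i hii
            rcases hε1 (s i) with e | e <;> rcases hσ with e' | e' <;> rw [e, e'] at hi ⊢ <;>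
              by_contra hcon <;> nlinarith
      have := Finset.card_lt_card hss
      rw [hcard] at this
      exact absurd (hle t) (not_le.2 this)
    have hsign : ∀ a, ε a ≠ -σ → ε a * σ = 1 := by
      intro a h
      rcases hε1 a with e | e <;> rcases hσ with e' | e' <;> rw [e, e'] at h ⊢ <;>
        first | (norm_num; done) | exact absurd (by norm_num) h
    have hsign' : ∀ a, ε a ≠ σ → ε a * σ = -1 := by
      intro a h
      rcases hε1 a with e | e <;> rcases hσ with e' | e' <;> rw [e, e'] at h ⊢ <;>
        first | (norm_num; done) | exact absurd (by norm_num) h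
    refine hR τ hτS σ hσ ?_ ?_
    · intro a ha haτ hmax
      obtain ⟨i₀, _, rfl⟩ := Finset.mem_image.1 ha
      by_contra hne
      obtain ⟨t, hta, ht⟩ := S.exists_lt_forall_lt_of_lt (s i₀)
      refine hcross t i₀ ?_ ?_ ?_
      · rw [hsign _ hne]; linarith
      · rw [hsign _ hne]; linarith
      · intro i hi
        rcases lt_or_gt_of_ne hi with h | h
        · have := ht _ (hsS i) h
          exact mul_pos (by linarith) (by linarith)
        · have : τ < s i := by
            by_contra hcon
            have h5 := hmax _ (hsS i)
              (lt_of_le_of_ne (not_lt.1 hcon) (fun e => hτs i (by rw [e]; ring)))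
            linarith
          exact mul_pos_of_neg_of_neg (by linarith) (by linarith)
    · intro a ha haτ hmin
      obtain ⟨i₀, _, rfl⟩ := Finset.mem_image.1 ha
      by_contra hne
      obtain ⟨t, hta, ht⟩ := S.exists_gt_forall_lt_of_gt (s i₀)
      refine hcross t i₀ ?_ ?_ ?_
      · rw [hsign' _ hne]; linarith
      · rw [hsign' _ hne]; linarith
      · intro i hi
        rcases lt_or_gt_of_ne hi with h | h
        · have : s i < τ := by
            by_contra hcon
            have h5 := hmin _ (hsS i)
              (lt_of_le_of_ne (not_lt.1 hcon) (fun e => hτs i (by rw [e]; ring)))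
            linarith
          exact mul_pos (by linarith) (by linarith)
        · have := ht _ (hsS i) h
          exact mul_pos_of_neg_of_neg (by linarith) (by linarith)
  rcases lt_or_gt_of_ne hc with h | h
  · have := main (-1) (Or.inr rfl) (by linarith)
    exact div_neg_of_pos_of_neg (by linarith) h
  · have := main 1 (Or.inl rfl) (by linarith)
    exact div_neg_of_neg_of_pos (by linarith) h

-- Multiplying by d = 1 + δi with a suitable δ makes all real parts nonzero. The excluded directions
-- Im(c/d) = 0 become Re(c z₀) = 0 with z₀ = I/d.
open Filter Topology in
theorem exists_pos_weights {ι : Type*} [Fintype ι] [Nonempty ι] (z : ι → ℂ)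
    (hz : ∀ i, z i ≠ 0) (hanti : ∀ i j (t : ℝ), 0 < t → z j ≠ -(t : ℂ) * z i) (r : ℕ)
    (hN : ∀ c : ℂ, c ≠ 0 → (Finset.univ.filter fun i => (c * z i).re < 0).card ≤ r) :
    ∃ (ω : ι → ℝ) (z₀ : ℂ), z₀ ≠ 0 ∧ (∀ i, 0 < ω i) ∧
      ∀ c : ℂ, (c * z₀).re ≠ 0 → (∀ i, (c * z i).re ≠ 0) →
      (Finset.univ.filter fun i => (c * z i).re < 0).card = r →
      ∑ i, ω i / (c * z i).re < 0 := by
  obtain ⟨δ, hδ⟩ := (eventually_all.2 fun i =>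
    eventually_re_mul_one_add_mul_I_ne_zero (hz i)).exists
  set d : ℂ := 1 + δ * Complex.I with hd
  have hd0 : d ≠ 0 := by
    intro h
    have := congrArg Complex.re h
    simp [hd] at this
  obtain ⟨ω, hω, h⟩ := exists_pos_weights_of_re_ne_zero (fun i => z i * d) hδ
    (fun i j t ht e => hanti i j t ht (mul_right_cancel₀ hd0 (by rw [e]; ring))) r
    (fun c hc => by
      have := hN (c * d) (mul_ne_zero hc hd0)
      have e : ∀ i, c * (z i * d) = c * d * z i := fun i => by ring
      simpa only [e] using this)
  refine ⟨ω, Complex.I / d, div_ne_zero Complex.I_ne_zero hd0, hω, fun c h0 h1 h2 => ?_⟩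
  have e : ∀ i, c / d * (z i * d) = c * z i := fun i => by field_simp
  have := h (c / d) ?_ (by simpa only [e] using h1) (by simpa only [e] using h2)
  · simpa only [e] using this
  · intro h3
    apply h0
    have : c * (Complex.I / d) = c / d * Complex.I := by ring
    rw [this, Complex.mul_I_re, h3, neg_zero]

/-! ### Subspaces on which a form is negative -/

section NegOn

variable {V : Type*} [NormedAddCommGroup V] [InnerProductSpace ℂ V]

/-- The real part of the quadratic form `x ↦ ⟪x, S x⟫` is negative definite on `U`. -/
def NegOn (S : V →ₗ[ℂ] V) (U : Submodule ℂ V) : Prop :=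
  ∀ x ∈ U, x ≠ 0 → (inner ℂ x (S x)).re < 0

/-- The sesquilinear form `⟪x, T y⟫` vanishes on `L`. -/
def TotallyIsotropic (T : V →ₗ[ℂ] V) (L : Submodule ℂ V) : Prop :=
  ∀ x ∈ L, ∀ y ∈ L, inner ℂ x (T y) = 0

theorem finrank_sup_span_singleton_of_notMem [FiniteDimensional ℂ V] {U : Submodule ℂ V} {u : V}
    (hu : u ∉ U) : Module.finrank ℂ ↥(U ⊔ ℂ ∙ u) = Module.finrank ℂ U + 1 := by
  have hu0 : u ≠ 0 := fun h => hu (h ▸ U.zero_mem)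
  have hd : Disjoint U (ℂ ∙ u) := by
    rw [Submodule.disjoint_span_singleton' hu0]
    exact hu
  have := Submodule.finrank_sup_add_finrank_inf_eq U (ℂ ∙ u)
  rw [hd.eq_bot, finrank_bot, finrank_span_singleton hu0] at this
  omega

theorem NegOn.sup_span_singleton {S : V →ₗ[ℂ] V} (hS : S.IsSymmetric) {U : Submodule ℂ V}
    (hU : NegOn S U) {u : V} (hu : (inner ℂ u (S u)).re < 0)
    (hUu : ∀ y ∈ U, inner ℂ y (S u) = 0) : NegOn S (U ⊔ ℂ ∙ u) := by
  intro x hx hx0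
  obtain ⟨y, hy, w, hw, rfl⟩ := Submodule.mem_sup.1 hx
  obtain ⟨t, rfl⟩ := Submodule.mem_span_singleton.1 hw
  have h1 : inner ℂ u (S y) = 0 := by
    rw [← hS u y, ← inner_conj_symm, hUu y hy, map_zero]
  have e : inner ℂ (y + t • u) (S (y + t • u)) =
      inner ℂ y (S y) + (Complex.normSq t : ℂ) * inner ℂ u (S u) := by
    simp only [map_add, map_smul, inner_add_left, inner_add_right, inner_smul_left,
      inner_smul_right, h1, hUu y hy, Complex.normSq_eq_conj_mul_self]
    ring
  rw [e, Complex.add_re, Complex.re_ofReal_mul]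
  by_cases hy0 : y = 0
  · have ht : t ≠ 0 := fun h => hx0 (by simp [hy0, h])
    have := mul_neg_of_pos_of_neg (Complex.normSq_pos.2 ht) hu
    simpa [hy0] using this
  · have h2 := hU y hy hy0
    have h3 := mul_nonpos_of_nonneg_of_nonpos (Complex.normSq_nonneg t) hu.le
    linarith

theorem NegOn.exists_finrank_add_one [FiniteDimensional ℂ V] {S : V →ₗ[ℂ] V}
    (hS : S.IsSymmetric) {U : Submodule ℂ V} (hU : NegOn S U) {u : V}
    (hu : (inner ℂ u (S u)).re < 0) (hUu : ∀ y ∈ U, inner ℂ y (S u) = 0) :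
    ∃ U' : Submodule ℂ V, NegOn S U' ∧ Module.finrank ℂ U' = Module.finrank ℂ U + 1 := by
  refine ⟨_, hU.sup_span_singleton hS hu hUu, finrank_sup_span_singleton_of_notMem fun h => ?_⟩
  rw [hUu u h] at hu
  simp at hu

/-- The compression of an operator to a subspace. -/
noncomputable def compression (T : V →ₗ[ℂ] V) (W : Submodule ℂ V) [W.HasOrthogonalProjection] :
    W →ₗ[ℂ] W :=
  W.orthogonalProjectionOnto.toLinearMap ∘ₗ T ∘ₗ W.subtype

theorem inner_compression (T : V →ₗ[ℂ] V) (W : Submodule ℂ V) [W.HasOrthogonalProjection]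
    (x y : W) : inner ℂ x (compression T W y) = inner ℂ (x : V) (T y) := by
  simp [compression]

/-- A hyperbolic plane argument: Sx, corrected by an element of U so as to become S-orthogonal to U,
still pairs with x to ‖Sx‖² > 0. Subtracting a multiple of the isotropic x keeps the orthogonality
and makes the form negative. Definiteness on U makes the compression invertible, which yields the
correction. -/
theorem NegOn.exists_finrank_add_one_of_isotropic [FiniteDimensional ℂ V] {S : V →ₗ[ℂ] V}
    (hS : S.IsSymmetric) {U : Submodule ℂ V} (hU : NegOn S U) {x : V}
    (hx : inner ℂ x (S x) = 0) (hSx : S x ≠ 0) (hUx : ∀ y ∈ U, inner ℂ y (S x) = 0) :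
    ∃ U' : Submodule ℂ V, NegOn S U' ∧ Module.finrank ℂ U' = Module.finrank ℂ U + 1 := by
  have hinj : Function.Injective (compression S U) := by
    rw [← LinearMap.ker_eq_bot, LinearMap.ker_eq_bot']
    intro u hu
    by_contra hu0
    have h1 := hU u u.2 (fun h => hu0 (Subtype.ext h))
    rw [← inner_compression, hu, inner_zero_right] at h1
    simp at h1
  obtain ⟨u₀, hu₀⟩ := (LinearMap.injective_iff_surjective.1 hinj)
    (U.orthogonalProjectionOnto (S (S x)))
  have hu₀' : ∀ u ∈ U, inner ℂ u (S u₀) = inner ℂ u (S (S x)) := by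
    intro u hu
    have := inner_compression S U ⟨u, hu⟩ u₀
    rw [← this, hu₀]
    simp
  set y := S x - (u₀ : V) with hy
  have hUy : ∀ u ∈ U, inner ℂ u (S y) = 0 := by
    intro u hu
    rw [hy, map_sub, inner_sub_right, hu₀' u hu, sub_self]
  have hyx : inner ℂ y (S x) = ((‖S x‖ ^ 2 : ℝ) : ℂ) := by
    rw [hy, inner_sub_left, hUx u₀ u₀.2, sub_zero, inner_self_eq_norm_sq_to_K]
    simp
  have hxy : inner ℂ x (S y) = ((‖S x‖ ^ 2 : ℝ) : ℂ) := by
    rw [← hS x y, ← inner_conj_symm, hyx, Complex.conj_ofReal]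
  have hpos : 0 < ‖S x‖ ^ 2 := by have := norm_pos_iff.2 hSx; positivity
  -- Chosen so that the real part of the form at y - t x is -1.
  set t : ℝ := ((inner ℂ y (S y)).re + 1) / (2 * ‖S x‖ ^ 2) with ht
  refine hU.exists_finrank_add_one hS (u := y - (t : ℂ) • x) ?_ ?_
  · have e : inner ℂ (y - (t : ℂ) • x) (S (y - (t : ℂ) • x)) =
        inner ℂ y (S y) - ((t * (2 * ‖S x‖ ^ 2) : ℝ) : ℂ) := by
      simp only [map_sub, map_smul, inner_sub_left, inner_sub_right, inner_smul_left,
        inner_smul_right, hx, hyx, hxy, Complex.conj_ofReal]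
      push_cast
      ring
    rw [e, Complex.sub_re, Complex.ofReal_re, ht, div_mul_cancel₀ _ (by positivity)]
    linarith
  · intro u hu
    rw [map_sub, map_smul, inner_sub_right, inner_smul_right, hUy u hu, hUx u hu]
    simp

/-- `c T + c̄ T*`. -/
noncomputable def symPart [FiniteDimensional ℂ V] (c : ℂ) (T : V →ₗ[ℂ] V) : V →ₗ[ℂ] V :=
  c • T + (starRingEnd ℂ c) • LinearMap.adjoint T

theorem inner_symPart [FiniteDimensional ℂ V] (c : ℂ) (T : V →ₗ[ℂ] V) (x y : V) :
    inner ℂ x (symPart c T y) =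
      c * inner ℂ x (T y) + (starRingEnd ℂ) (c * inner ℂ y (T x)) := by
  simp [symPart, LinearMap.adjoint_inner_right]

theorem symPart_isSymmetric [FiniteDimensional ℂ V] (c : ℂ) (T : V →ₗ[ℂ] V) :
    (symPart c T).IsSymmetric := by
  intro x y
  rw [← inner_conj_symm, inner_symPart, inner_symPart, map_add, Complex.conj_conj, add_comm]

theorem negOn_symPart [FiniteDimensional ℂ V] (c : ℂ) (T : V →ₗ[ℂ] V) (U : Submodule ℂ V) :
    NegOn (symPart c T) U ↔ NegOn (c • T) U := by
  unfold NegOn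
  refine forall₃_congr fun x _ _ => ?_
  rw [inner_symPart, Complex.add_re, Complex.conj_re, LinearMap.smul_apply, inner_smul_right]
  constructor <;> intro h <;> linarith

-- By compactness of the unit sphere of U, negativity is an open condition on c. This lets an
-- exceptional c be rotated slightly without losing U.
open Filter Topology in
theorem NegOn.eventually [FiniteDimensional ℂ V] {T : V →ₗ[ℂ] V} {U : Submodule ℂ V} {c : ℂ}
    (h : NegOn (c • T) U) :
    ∀ᶠ δ : ℝ in 𝓝[>] 0, NegOn ((c * (1 + δ * Complex.I)) • T) U := by
  have hT : Continuous T := T.continuous_of_finiteDimensional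
  have hK : IsCompact (Metric.sphere (0 : U) 1) := isCompact_sphere 0 1
  have h1 : ∀ᶠ δ : ℝ in 𝓝 0, ∀ x ∈ Metric.sphere (0 : U) 1,
      (c * (1 + δ * Complex.I) * inner ℂ (x : V) (T x)).re < 0 := by
    refine hK.eventually_forall_of_forall_eventually fun x hx => ?_
    have hc : Continuous fun z : ℝ × U =>
        (c * (1 + z.1 * Complex.I) * inner ℂ (z.2 : V) (T z.2)).re := by
      fun_prop
    refine (hc.tendsto (0, x)).eventually_lt_const ?_
    have hx0 : (x : V) ≠ 0 := by
      intro h0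
      have : ‖x‖ = 1 := by simpa using hx
      rw [Submodule.coe_norm, h0, norm_zero] at this
      norm_num at this
    have := h x x.2 hx0
    rw [LinearMap.smul_apply, inner_smul_right] at this
    simpa using this
  refine (h1.filter_mono nhdsWithin_le_nhds).mono fun δ hδ x hx hx0 => ?_
  have hn : 0 < ‖x‖ := norm_pos_iff.2 hx0
  have h2 := hδ (((‖x‖⁻¹ : ℝ) : ℂ) • ⟨x, hx⟩) (by
    rw [mem_sphere_zero_iff_norm, norm_smul]
    simp [hn.ne'])
  rw [LinearMap.smul_apply, inner_smul_right]
  simp only [Submodule.coe_smul, map_smul, inner_smul_left, inner_smul_right,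
    Complex.conj_ofReal] at h2
  have e : c * (1 + δ * Complex.I) * (((‖x‖⁻¹ : ℝ) : ℂ) * (((‖x‖⁻¹ : ℝ) : ℂ) * inner ℂ x (T x)))
      = ((‖x‖⁻¹ * ‖x‖⁻¹ : ℝ) : ℂ) * (c * (1 + δ * Complex.I) * inner ℂ x (T x)) := by
    push_cast; ring
  rw [e, Complex.re_ofReal_mul] at h2
  have hp : 0 < ‖x‖⁻¹ * ‖x‖⁻¹ := by positivity
  by_contra hcon
  exact absurd h2 (not_lt.2 (mul_nonneg hp.le (not_lt.1 hcon)))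

theorem one_add_mul_I_ne_zero (δ : ℝ) : (1 + δ * Complex.I : ℂ) ≠ 0 := by
  intro h
  have := congrArg Complex.re h
  simp at this

theorem TotallyIsotropic.sup_span_singleton {T : V →ₗ[ℂ] V} {L : Submodule ℂ V}
    (hL : TotallyIsotropic T L) {x : V} (hx : inner ℂ x (T x) = 0)
    (h1 : ∀ y ∈ L, inner ℂ x (T y) = 0) (h2 : ∀ y ∈ L, inner ℂ y (T x) = 0) :
    TotallyIsotropic T (L ⊔ ℂ ∙ x) := by
  intro u hu v hv
  obtain ⟨y, hy, w, hw, rfl⟩ := Submodule.mem_sup.1 hu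
  obtain ⟨s, rfl⟩ := Submodule.mem_span_singleton.1 hw
  obtain ⟨y', hy', w', hw', rfl⟩ := Submodule.mem_sup.1 hv
  obtain ⟨s', rfl⟩ := Submodule.mem_span_singleton.1 hw'
  simp [hx, h1 y' hy',
    h2 y hy, hL y hy y' hy']

end NegOn

/-! ### Splitting off an isotropic vector, and diagonalisation -/

section Reduction

variable {V : Type*} [NormedAddCommGroup V] [InnerProductSpace ℂ V] [FiniteDimensional ℂ V]

/-- Every subspace on which some nonzero multiple of the form has negative definite real part has
dimension at most `r`. -/
def NegIndexLE (T : V →ₗ[ℂ] V) (W : Submodule ℂ V) (r : ℕ) : Prop :=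
  ∀ c : ℂ, c ≠ 0 → ∀ U ≤ W, NegOn (c • T) U → Module.finrank ℂ U ≤ r

/-- `W` contains a totally isotropic subspace of codimension at most `r`. -/
def HasIsotropic (T : V →ₗ[ℂ] V) (W : Submodule ℂ V) (r : ℕ) : Prop :=
  ∃ L ≤ W, TotallyIsotropic T L ∧ Module.finrank ℂ W ≤ Module.finrank ℂ L + r

/-- If w = 0, then x lies in the radical and splits off at no cost. Otherwise pass to the orthogonal
complement of x and w: the dimension drops by two and the index bound by one, since any negative
subspace there can be enlarged through x. Adjoining x to the isotropic subspace balances the count.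
-/
theorem HasIsotropic.of_isotropic_vector {T : V →ₗ[ℂ] V}
    (ih : ∀ W : Submodule ℂ V, W ≠ ⊤ → ∀ r, NegIndexLE T W r → HasIsotropic T W r)
    {r : ℕ} (hr : NegIndexLE T ⊤ r) {x : V} (hx0 : x ≠ 0) (hx : inner ℂ x (T x) = 0)
    {w : V} {p q : ℂ} (hp : LinearMap.adjoint T x = p • w) (hq : T x = q • w)
    (hpq : p ≠ 0 ∨ q ≠ 0) : HasIsotropic T ⊤ r := by
  by_cases hw : w = 0
  · rw [hw, smul_zero] at hp hq
    have hdim := (ℂ ∙ x).finrank_add_finrank_orthogonal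
    rw [finrank_span_singleton hx0] at hdim
    have hxW : x ∉ (ℂ ∙ x)ᗮ := by
      rw [Submodule.mem_orthogonal_singleton_iff_inner_right]
      exact fun h => hx0 (inner_self_eq_zero.1 h)
    obtain ⟨L, hLW, hL, hLr⟩ := ih (ℂ ∙ x)ᗮ (fun h => hxW (h ▸ Submodule.mem_top)) r
      (fun c hc U _ hU => hr c hc U le_top hU)
    refine ⟨L ⊔ ℂ ∙ x, le_top, hL.sup_span_singleton hx ?_ ?_, ?_⟩
    · intro y _
      rw [← LinearMap.adjoint_inner_left, hp, inner_zero_left]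
    · intro y _
      rw [hq, inner_zero_right]
    · rw [finrank_sup_span_singleton_of_notMem fun h => hxW (hLW h), finrank_top]
      omega
  · have hxw : inner ℂ x w = 0 := by
      rcases hpq with h | h
      · have h1 : inner ℂ x (LinearMap.adjoint T x) = 0 := by
          rw [LinearMap.adjoint_inner_right, ← inner_conj_symm, hx, map_zero]
        rw [hp, inner_smul_right] at h1
        exact (mul_eq_zero.1 h1).resolve_left h
      · rw [hq, inner_smul_right] at hx
        exact (mul_eq_zero.1 hx).resolve_left h
    have hwx : w ∉ (ℂ ∙ x) := by
      intro h
      obtain ⟨s, rfl⟩ := Submodule.mem_span_singleton.1 h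
      rw [inner_smul_right] at hxw
      rcases mul_eq_zero.1 hxw with h' | h'
      · exact hw (by rw [h', zero_smul])
      · exact hx0 (inner_self_eq_zero.1 h')
    have hdim := ((ℂ ∙ x) ⊔ (ℂ ∙ w)).finrank_add_finrank_orthogonal
    rw [finrank_sup_span_singleton_of_notMem hwx, finrank_span_singleton hx0] at hdim
    set W := ((ℂ ∙ x) ⊔ (ℂ ∙ w))ᗮ with hW
    have hWx : ∀ y ∈ W, inner ℂ x y = 0 := fun y hy =>
      (Submodule.mem_orthogonal _ _).1 hy x
        (Submodule.mem_sup_left (Submodule.mem_span_singleton_self x))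
    have hWw : ∀ y ∈ W, inner ℂ w y = 0 := fun y hy =>
      (Submodule.mem_orthogonal _ _).1 hy w
        (Submodule.mem_sup_right (Submodule.mem_span_singleton_self w))
    have hxW : x ∉ W := fun h => hx0 (inner_self_eq_zero.1 (hWx x h))
    have h1 : ∀ y ∈ W, inner ℂ x (T y) = 0 := by
      intro y hy
      rw [← LinearMap.adjoint_inner_left, hp, inner_smul_left, hWw y hy, mul_zero]
    have h2 : ∀ y ∈ W, inner ℂ y (T x) = 0 := by
      intro y hy
      rw [hq, inner_smul_right, ← inner_conj_symm, hWw y hy, map_zero, mul_zero]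
    have key : ∀ c : ℂ, c ≠ 0 → c * q + (starRingEnd ℂ c) * p ≠ 0 → ∀ U ≤ W,
        NegOn (c • T) U → Module.finrank ℂ U + 1 ≤ r := by
      intro c hc hcpq U hUW hU
      have hSx : symPart c T x = (c * q + (starRingEnd ℂ c) * p) • w := by
        simp only [symPart, LinearMap.add_apply, LinearMap.smul_apply, hp, hq, smul_smul, add_smul]
      obtain ⟨U', hU', hdU⟩ := ((negOn_symPart c T U).2 hU).exists_finrank_add_one_of_isotropic
        (symPart_isSymmetric c T) (x := x) (by rw [inner_symPart, hx]; simp)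
        (by rw [hSx]; exact smul_ne_zero hcpq hw)
        (fun y hy => by rw [inner_symPart, h1 y (hUW hy), h2 y (hUW hy)]; simp)
      rw [← hdU]
      exact hr c hc U' le_top ((negOn_symPart c T U').1 hU')
    -- If cq + c̄p = 0, the symmetric part kills x. A small rotation of c repairs this because p and
    -- q are not both zero.
    have key' : ∀ c : ℂ, c ≠ 0 → ∀ U ≤ W, NegOn (c • T) U → Module.finrank ℂ U + 1 ≤ r := by
      intro c hc U hUW hU
      by_cases hcpq : c * q + (starRingEnd ℂ c) * p = 0
      · obtain ⟨δ, hδ, hδ0⟩ := (hU.eventually.and self_mem_nhdsWithin).exists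
        have hδ0' : (δ : ℂ) ≠ 0 := Complex.ofReal_ne_zero.2 (ne_of_gt hδ0)
        refine key _ (mul_ne_zero hc (one_add_mul_I_ne_zero δ)) ?_ U hUW hδ
        have e : c * (1 + δ * Complex.I) * q +
            (starRingEnd ℂ) (c * (1 + δ * Complex.I)) * p =
            (c * q + (starRingEnd ℂ c) * p) +
              δ * Complex.I * (c * q - (starRingEnd ℂ c) * p) := by
          simp only [map_mul, map_add, map_one, Complex.conj_ofReal, Complex.conj_I]
          ring
        rw [e, hcpq, zero_add]
        refine mul_ne_zero (mul_ne_zero hδ0' Complex.I_ne_zero) fun h => ?_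
        have hcq : c * q = 0 := by linear_combination (hcpq + h) / 2
        have hcp : (starRingEnd ℂ c) * p = 0 := by linear_combination (hcpq - h) / 2
        have hc' : (starRingEnd ℂ c) ≠ 0 := by simpa using hc
        rcases hpq with h' | h'
        · exact h' ((mul_eq_zero.1 hcp).resolve_left hc')
        · exact h' ((mul_eq_zero.1 hcq).resolve_left hc)
      · exact key c hc hcpq U hUW hU
    -- The zero subspace already gives r ≥ 1, so `r - 1` is not truncated.
    have hr1 : 1 ≤ r := by
      have := key' 1 one_ne_zero ⊥ bot_le (fun x hx hx0 => absurd ((Submodule.mem_bot ℂ).1 hx) hx0)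
      omega
    obtain ⟨L, hLW, hL, hLr⟩ := ih W (fun h => hxW (h ▸ Submodule.mem_top)) (r - 1)
      (fun c hc U hUW hU => by have := key' c hc U hUW hU; omega)
    refine ⟨L ⊔ ℂ ∙ x, le_top, hL.sup_span_singleton hx (fun y hy => h1 y (hLW hy))
      (fun y hy => h2 y (hLW hy)), ?_⟩
    rw [finrank_sup_span_singleton_of_notMem fun h => hxW (hLW h), finrank_top]
    omega

/-- The vectors are eigenvectors of C = (T*)⁻¹T. The orthogonal complement F of the T(e i) is
C-invariant, because T(e i) and T*(e i) are proportional, and it is nonzero by dimension, so it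
contains the next eigenvector. -/
theorem exists_orthogonal_eigenfamily {T : V →ₗ[ℂ] V} (hT : Function.Injective T) :
    ∀ m ≤ Module.finrank ℂ V, ∃ e : Fin m → V, (∀ i, e i ≠ 0) ∧
      (∀ i, ∃ μ : ℂ, T (e i) = μ • LinearMap.adjoint T (e i)) ∧
      ∀ i j, i ≠ j → inner ℂ (e i) (T (e j)) = 0 := by
  have hT' : Function.Injective (LinearMap.adjoint T) := by
    rw [← LinearMap.ker_eq_bot, LinearMap.ker_eq_bot']
    intro y hy
    obtain ⟨x, rfl⟩ := (LinearMap.injective_iff_surjective.1 hT) y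
    have h : inner ℂ (T x) (T x) = 0 := by
      rw [← LinearMap.adjoint_inner_left, hy, inner_zero_left]
    exact inner_self_eq_zero.1 h
  set C : V →ₗ[ℂ] V :=
    (LinearEquiv.ofInjectiveEndo (LinearMap.adjoint T) hT').symm.toLinearMap ∘ₗ T with hC
  have hCT : ∀ y, LinearMap.adjoint T (C y) = T y := fun y =>
    (LinearEquiv.ofInjectiveEndo (LinearMap.adjoint T) hT').apply_symm_apply (T y)
  intro m
  induction m with
  | zero => exact fun _ => ⟨Fin.elim0, fun i => i.elim0, fun i => i.elim0, fun i => i.elim0⟩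
  | succ m ih =>
    intro hm
    obtain ⟨e, he0, hev, heo⟩ := ih (by omega)
    set F : Submodule ℂ V := (Submodule.span ℂ (Set.range fun i => T (e i)))ᗮ with hF
    have hmemF : ∀ y, y ∈ F ↔ ∀ i, inner ℂ (T (e i)) y = 0 := by
      intro y
      rw [hF, Submodule.mem_orthogonal]
      constructor
      · exact fun h i => h _ (Submodule.subset_span ⟨i, rfl⟩)
      · intro h u hu
        induction hu using Submodule.span_induction with
        | mem u hu => obtain ⟨i, rfl⟩ := hu; exact h i
        | zero => exact inner_zero_left _
        | add u v _ _ hu hv => rw [inner_add_left, hu, hv, add_zero]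
        | smul t u _ hu => rw [inner_smul_left, hu, mul_zero]
    have hadj : ∀ y ∈ F, ∀ i, inner ℂ (LinearMap.adjoint T (e i)) y = 0 := by
      intro y hy i
      obtain ⟨μ, hμ⟩ := hev i
      have hμ0 : μ ≠ 0 := by
        rintro rfl
        rw [zero_smul] at hμ
        exact he0 i (hT (by rw [hμ, map_zero]))
      have h1 := (hmemF y).1 hy i
      rw [hμ, inner_smul_left] at h1
      exact (mul_eq_zero.1 h1).resolve_left (by simpa using hμ0)
    have hCF : ∀ y ∈ F, C y ∈ F := by
      intro y hy
      rw [hmemF]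
      intro i
      rw [← LinearMap.adjoint_inner_right, hCT, ← LinearMap.adjoint_inner_left]
      exact hadj y hy i
    have hFdim : 0 < Module.finrank ℂ F := by
      have h1 : Module.finrank ℂ ↥(Submodule.span ℂ (Set.range fun i => T (e i))) +
          Module.finrank ℂ F = Module.finrank ℂ V := Submodule.finrank_add_finrank_orthogonal _
      have h2 := finrank_range_le_card (R := ℂ) (fun i => T (e i))
      rw [Fintype.card_fin] at h2
      have h3 : Module.finrank ℂ ↥(Submodule.span ℂ (Set.range fun i => T (e i))) ≤ m := h2
      omega
    have : Nontrivial F := Module.finrank_pos_iff.1 hFdim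
    obtain ⟨μ, hμ⟩ := Module.End.exists_eigenvalue (C.restrict hCF)
    obtain ⟨⟨x, hxF⟩, hx⟩ := hμ.exists_hasEigenvector
    have hx0 : x ≠ 0 := fun h => hx.2 (Subtype.ext h)
    have hCx : C x = μ • x := by
      have := congrArg Subtype.val hx.apply_eq_smul
      simpa using this
    have hTx : T x = μ • LinearMap.adjoint T x := by rw [← hCT x, hCx, map_smul]
    refine ⟨Fin.cons x e, ?_, ?_, ?_⟩
    · exact Fin.cases hx0 he0
    · exact Fin.cases ⟨μ, hTx⟩ hev
    · intro i j
      refine Fin.cases ?_ (fun i => ?_) i <;> refine Fin.cases ?_ (fun j => ?_) j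
      · simp
      · intro _
        simp only [Fin.cons_zero, Fin.cons_succ]
        rw [← inner_conj_symm, (hmemF x).1 hxF j, map_zero]
      · intro _
        simp only [Fin.cons_zero, Fin.cons_succ]
        rw [← LinearMap.adjoint_inner_left]
        exact hadj x hxF i
      · intro hij
        simp only [Fin.cons_succ]
        exact heo i j (fun h => hij (by rw [h]))

theorem exists_orthogonal_eigenbasis {T : V →ₗ[ℂ] V} (hT : Function.Injective T)
    (haniso : ∀ x ≠ 0, ∀ μ : ℂ, T x = μ • LinearMap.adjoint T x → inner ℂ x (T x) ≠ 0) :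
    ∃ b : Module.Basis (Fin (Module.finrank ℂ V)) ℂ V,
      (∀ i, ∃ μ : ℂ, T (b i) = μ • LinearMap.adjoint T (b i)) ∧
      ∀ i j, i ≠ j → inner ℂ (b i) (T (b j)) = 0 := by
  obtain ⟨e, he0, hev, heo⟩ := exists_orthogonal_eigenfamily hT _ le_rfl
  have hli : LinearIndependent ℂ e := by
    rw [Fintype.linearIndependent_iff]
    intro g hg i
    have h1 : inner ℂ (e i) (T (∑ j, g j • e j)) = g i * inner ℂ (e i) (T (e i)) := by
      rw [map_sum, inner_sum, Finset.sum_eq_single i]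
      · rw [map_smul, inner_smul_right]
      · intro j _ hj
        rw [map_smul, inner_smul_right, heo i j hj.symm, mul_zero]
      · simp
    rw [hg, map_zero, inner_zero_right] at h1
    obtain ⟨μ, hμ⟩ := hev i
    exact (mul_eq_zero.1 h1.symm).resolve_right (haniso _ (he0 i) μ hμ)
  have hspan : ⊤ ≤ Submodule.span ℂ (Set.range e) :=
    (hli.span_eq_top_of_card_eq_finrank' (by simp)).ge
  refine ⟨Module.Basis.mk hli hspan, ?_, ?_⟩
  · simpa only [Module.Basis.mk_apply] using hev
  · simpa only [Module.Basis.mk_apply] using heo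

end Reduction

/-! ### Forms diagonal in a basis -/

section Diagonal

variable {V : Type*} [NormedAddCommGroup V] [InnerProductSpace ℂ V]

theorem inner_eq_sum_of_orthogonal {ι : Type*} [Fintype ι] {T : V →ₗ[ℂ] V}
    (b : Module.Basis ι ℂ V) (hb : ∀ i j, i ≠ j → inner ℂ (b i) (T (b j)) = 0) (x y : V) :
    inner ℂ x (T y) =
      ∑ i, (starRingEnd ℂ) (b.repr x i) * b.repr y i * inner ℂ (b i) (T (b i)) := by
  conv_lhs => rw [← b.sum_repr x, ← b.sum_repr y]
  rw [map_sum, sum_inner]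
  refine Finset.sum_congr rfl fun i _ => ?_
  rw [inner_sum, Finset.sum_eq_single i]
  · rw [map_smul, inner_smul_left, inner_smul_right]; ring
  · intro j _ hj
    rw [map_smul, inner_smul_left, inner_smul_right, hb i j hj.symm]; ring
  · simp

theorem re_mul_inner_eq_sum_of_orthogonal {ι : Type*} [Fintype ι] {T : V →ₗ[ℂ] V}
    (b : Module.Basis ι ℂ V) (hb : ∀ i j, i ≠ j → inner ℂ (b i) (T (b j)) = 0) (c : ℂ) (x : V) :
    (c * inner ℂ x (T x)).re =
      ∑ i, Complex.normSq (b.repr x i) * (c * inner ℂ (b i) (T (b i))).re := by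
  rw [inner_eq_sum_of_orthogonal b hb, Finset.mul_sum, Complex.re_sum]
  refine Finset.sum_congr rfl fun i _ => ?_
  rw [← Complex.normSq_eq_conj_mul_self, ← Complex.re_ofReal_mul]
  congr 1
  ring

/-- Half of Sylvester's law of inertia: the basis vectors with negative value span a negative
subspace. -/
theorem card_re_neg_le_of_negIndexLE {ι : Type*} [Fintype ι] {T : V →ₗ[ℂ] V}
    (b : Module.Basis ι ℂ V) (hb : ∀ i j, i ≠ j → inner ℂ (b i) (T (b j)) = 0) {r : ℕ}
    (hr : NegIndexLE T ⊤ r) {c : ℂ} (hc : c ≠ 0) :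
    (Finset.univ.filter fun i => (c * inner ℂ (b i) (T (b i))).re < 0).card ≤ r := by
  classical
  set s : Set ι := {i | (c * inner ℂ (b i) (T (b i))).re < 0} with hs
  have hneg : NegOn (c • T) (Submodule.span ℂ (b '' s)) := by
    intro x hx hx0
    rw [Module.Basis.mem_span_image] at hx
    rw [LinearMap.smul_apply, inner_smul_right, re_mul_inner_eq_sum_of_orthogonal b hb]
    have hle : ∀ i ∈ Finset.univ, Complex.normSq (b.repr x i) *
        (c * inner ℂ (b i) (T (b i))).re ≤ 0 := by
      intro i _
      by_cases h : b.repr x i = 0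
      · simp [h]
      · have : i ∈ s := hx (Finsupp.mem_support_iff.2 h)
        exact mul_nonpos_of_nonneg_of_nonpos (Complex.normSq_nonneg _) (le_of_lt this)
    obtain ⟨i, hi⟩ : ∃ i, b.repr x i ≠ 0 := by
      by_contra! hcon
      exact hx0 (b.repr.map_eq_zero_iff.1 (Finsupp.ext hcon))
    have his : i ∈ s := hx (Finsupp.mem_support_iff.2 hi)
    refine Finset.sum_neg' hle ⟨i, Finset.mem_univ i, ?_⟩
    exact mul_neg_of_pos_of_neg (Complex.normSq_pos.2 hi) his
  have hcard : Module.finrank ℂ (Submodule.span ℂ (b '' s)) =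
      (Finset.univ.filter fun i => (c * inner ℂ (b i) (T (b i))).re < 0).card := by
    have h1 : LinearIndependent ℂ (fun i : s => b i) :=
      b.linearIndependent.comp _ Subtype.val_injective
    have h2 := finrank_span_eq_card h1
    rw [Set.image_eq_range, h2, Fintype.card_subtype]
    rfl
  rw [← hcard]
  exact hr c hc _ le_top hneg

/-- The other half: on a negative subspace the coordinates with negative value are jointly
injective. -/
theorem NegOn.finrank_le_card {ι : Type*} [Fintype ι] {T : V →ₗ[ℂ] V}
    (b : Module.Basis ι ℂ V) (hb : ∀ i j, i ≠ j → inner ℂ (b i) (T (b j)) = 0) {c : ℂ}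
    {U : Submodule ℂ V} (hU : NegOn (c • T) U) :
    Module.finrank ℂ U ≤
      (Finset.univ.filter fun i => (c * inner ℂ (b i) (T (b i))).re < 0).card := by
  classical
  set s := Finset.univ.filter fun i => (c * inner ℂ (b i) (T (b i))).re < 0 with hs
  let f : U →ₗ[ℂ] (s → ℂ) := LinearMap.pi fun i => b.coord i ∘ₗ U.subtype
  have hf : Function.Injective f := by
    rw [← LinearMap.ker_eq_bot, LinearMap.ker_eq_bot']
    intro x hx
    by_contra hx0
    have h1 := hU x x.2 (fun h => hx0 (Subtype.ext h))
    rw [LinearMap.smul_apply, inner_smul_right, re_mul_inner_eq_sum_of_orthogonal b hb] at h1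
    refine absurd h1 (not_lt.2 (Finset.sum_nonneg fun i _ => ?_))
    by_cases hi : i ∈ s
    · have : b.repr (x : V) i = 0 := congrFun hx ⟨i, hi⟩
      simp [this]
    · have h2 : ¬ (c * inner ℂ (b i) (T (b i))).re < 0 := by simpa [hs] using hi
      exact mul_nonneg (Complex.normSq_nonneg _) (not_lt.1 h2)
  have := LinearMap.finrank_le_finrank_of_injective hf
  rwa [Module.finrank_fintype_fun_eq_card, Fintype.card_coe] at this

variable [FiniteDimensional ℂ V]

-- The hyperplane is the kernel of g = Σ √ω_i x_i. For c with the maximal count r of negative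
-- values, it is orthogonal for the symmetric part of cT to a vector u at which the form is
-- negative, so every negative subspace of the hyperplane can be enlarged by u.
open Filter Topology in
theorem HasIsotropic.of_orthogonal_basis {ι : Type*} [Fintype ι] [Nonempty ι] {T : V →ₗ[ℂ] V}
    (ih : ∀ W : Submodule ℂ V, W ≠ ⊤ → ∀ r, NegIndexLE T W r → HasIsotropic T W r)
    {r : ℕ} (hr : NegIndexLE T ⊤ r) (b : Module.Basis ι ℂ V)
    (hb : ∀ i j, i ≠ j → inner ℂ (b i) (T (b j)) = 0)
    (hb0 : ∀ i, inner ℂ (b i) (T (b i)) ≠ 0)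
    (hanti : ∀ i j (t : ℝ), 0 < t →
      inner ℂ (b j) (T (b j)) ≠ -(t : ℂ) * inner ℂ (b i) (T (b i))) :
    HasIsotropic T ⊤ r := by
  classical
  obtain ⟨ω, z₀, hz₀, hω, H⟩ := exists_pos_weights (fun i => inner ℂ (b i) (T (b i))) hb0 hanti r
    (fun c hc => card_re_neg_le_of_negIndexLE b hb hr hc)
  set g : Module.Dual ℂ V := ∑ i, ((√(ω i) : ℝ) : ℂ) • b.coord i with hg
  have hgx : ∀ x, g x = ∑ i, ((√(ω i) : ℝ) : ℂ) * b.repr x i := by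
    intro x
    simp [hg]
  have hg0 : g ≠ 0 := by
    intro h
    obtain ⟨i⟩ := ‹Nonempty ι›
    have h1 : g (b i) = 0 := by rw [h, LinearMap.zero_apply]
    rw [hgx, Finset.sum_eq_single i] at h1
    · simp [(Real.sqrt_pos.2 (hω i)).ne'] at h1
    · intro j _ hj
      simp [Finsupp.single_eq_of_ne hj]
    · simp
  have hdim := Module.Dual.finrank_ker_add_one_of_ne_zero hg0
  have key : ∀ c : ℂ, c ≠ 0 → (c * z₀).re ≠ 0 →
      (∀ i, (c * inner ℂ (b i) (T (b i))).re ≠ 0) →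
      ∀ U ≤ LinearMap.ker g, NegOn (c • T) U → Module.finrank ℂ U + 1 ≤ r := by
    intro c hc hc0 hgen U hUg hU
    have hcard := card_re_neg_le_of_negIndexLE b hb hr hc
    rcases hcard.lt_or_eq with hlt | heq
    · exact lt_of_le_of_lt (hU.finrank_le_card b hb) hlt
    · have hneg := H c hc0 hgen heq
      set h : ι → ℝ := fun i => (c * inner ℂ (b i) (T (b i))).re with hh
      -- With these coordinates the real part of c⟪u, Tu⟫ is Σ ω_i / h_i, and the symmetric part
      -- pairs y with u to 2 · conj(g y).
      obtain ⟨u, hui⟩ : ∃ u : V, ∀ i, b.repr u i = ((√(ω i) / h i : ℝ) : ℂ) :=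
        ⟨∑ i, ((√(ω i) / h i : ℝ) : ℂ) • b i, fun i => by rw [b.repr_sum_self]⟩
      have huu : (c * inner ℂ u (T u)).re < 0 := by
        rw [re_mul_inner_eq_sum_of_orthogonal b hb]
        convert hneg using 1
        refine Finset.sum_congr rfl fun i _ => ?_
        rw [hui, Complex.normSq_ofReal]
        have h1 : h i ≠ 0 := hgen i
        have h2 := Real.mul_self_sqrt (hω i).le
        change √(ω i) / h i * (√(ω i) / h i) * h i = ω i / h i
        field_simp
        rw [sq, h2]
      have hUu : ∀ y ∈ U, inner ℂ y (symPart c T u) = 0 := by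
        intro y hy
        have hgy : g y = 0 := hUg hy
        rw [inner_symPart, inner_eq_sum_of_orthogonal b hb y u,
          inner_eq_sum_of_orthogonal b hb u y, Finset.mul_sum, Finset.mul_sum, map_sum,
          ← Finset.sum_add_distrib]
        have h3 : (2 : ℂ) * (starRingEnd ℂ) (g y) = 0 := by rw [hgy, map_zero, mul_zero]
        rw [hgx, map_sum, Finset.mul_sum] at h3
        rw [← h3]
        refine Finset.sum_congr rfl fun i _ => ?_
        have h1 : (h i : ℂ) ≠ 0 := Complex.ofReal_ne_zero.2 (hgen i)
        have h4 : c * inner ℂ (b i) (T (b i)) +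
            (starRingEnd ℂ) (c * inner ℂ (b i) (T (b i))) = 2 * (h i : ℂ) := by
          rw [Complex.add_conj]
          simp [hh]
        rw [map_mul] at h4
        simp only [map_mul, hui, Complex.conj_ofReal]
        calc _ = (starRingEnd ℂ) (b.repr y i) * ((√(ω i) / h i : ℝ) : ℂ) *
              (c * inner ℂ (b i) (T (b i)) +
                (starRingEnd ℂ) c * (starRingEnd ℂ) (inner ℂ (b i) (T (b i)))) := by ring
          _ = _ := by
            rw [h4]
            push_cast
            field_simp
      obtain ⟨U', hU', hdU⟩ := ((negOn_symPart c T U).2 hU).exists_finrank_add_one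
        (symPart_isSymmetric c T) (u := u)
        (by
          rw [inner_symPart, Complex.add_re, Complex.conj_re]
          linarith) hUu
      rw [← hdU]
      exact hr c hc U' le_top ((negOn_symPart c T U').1 hU')
  have key' : ∀ c : ℂ, c ≠ 0 → ∀ U ≤ LinearMap.ker g, NegOn (c • T) U →
      Module.finrank ℂ U + 1 ≤ r := by
    intro c hc U hUg hU
    have e : ∀ (δ : ℝ) (z : ℂ), c * (1 + δ * Complex.I) * z = c * z * (1 + δ * Complex.I) :=
      fun δ z => by ring
    -- One small rotation of c avoids all exceptional directions and keeps U negative.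
    obtain ⟨δ, h1, h2, h3⟩ := (hU.eventually.and
      ((eventually_re_mul_one_add_mul_I_ne_zero (mul_ne_zero hc hz₀)).and
        (eventually_all.2 fun i =>
          eventually_re_mul_one_add_mul_I_ne_zero (mul_ne_zero hc (hb0 i))))).exists
    exact key _ (mul_ne_zero hc (one_add_mul_I_ne_zero δ)) (by rw [e]; exact h2)
      (fun i => by rw [e]; exact h3 i) U hUg h1
  have hr1 : 1 ≤ r := by
    have := key' 1 one_ne_zero ⊥ bot_le (fun x hx hx0 => absurd ((Submodule.mem_bot ℂ).1 hx) hx0)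
    omega
  obtain ⟨L, hLW, hL, hLr⟩ := ih (LinearMap.ker g) (fun h => hg0 (LinearMap.ker_eq_top.1 h)) (r - 1)
    (fun c hc U hUW hU => by have := key' c hc U hUW hU; omega)
  refine ⟨L, le_top, hL, ?_⟩
  rw [finrank_top]
  omega

end Diagonal

/-! ### The induction on dimension -/

theorem HasIsotropic.of_compression {V : Type*} [NormedAddCommGroup V] [InnerProductSpace ℂ V]
    [FiniteDimensional ℂ V] {T : V →ₗ[ℂ] V} {W : Submodule ℂ V} {r : ℕ}
    (h : HasIsotropic (compression T W) ⊤ r) : HasIsotropic T W r := by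
  obtain ⟨L, _, hL, hLr⟩ := h
  refine ⟨L.map W.subtype, Submodule.map_subtype_le W L, ?_, ?_⟩
  · rintro _ ⟨x, hx, rfl⟩ _ ⟨y, hy, rfl⟩
    have := hL x hx y hy
    rwa [inner_compression] at this
  · rw [finrank_top] at hLr
    rwa [Submodule.finrank_map_subtype_eq]

theorem NegIndexLE.compression {V : Type*} [NormedAddCommGroup V] [InnerProductSpace ℂ V]
    [FiniteDimensional ℂ V] {T : V →ₗ[ℂ] V} {W : Submodule ℂ V} {r : ℕ}
    (h : NegIndexLE T W r) : NegIndexLE (compression T W) ⊤ r := by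
  intro c hc U _ hU
  rw [← Submodule.finrank_map_subtype_eq]
  refine h c hc _ (Submodule.map_subtype_le W U) ?_
  rintro _ ⟨x, hx, rfl⟩ hx0
  have := hU x hx (fun h => hx0 (by rw [h, map_zero]))
  rw [LinearMap.smul_apply, inner_smul_right, inner_compression] at this
  rw [LinearMap.smul_apply, inner_smul_right]
  exact this

/-- A sesquilinear form such that the real part of each of its nonzero multiples has negative
index at most `r` has a totally isotropic subspace of codimension at most `r`. -/
theorem NegIndexLE.hasIsotropic {V : Type*} [NormedAddCommGroup V] [InnerProductSpace ℂ V]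
    [FiniteDimensional ℂ V] {T : V →ₗ[ℂ] V} {r : ℕ} (h : NegIndexLE T ⊤ r) :
    HasIsotropic T ⊤ r := by
  induction hn : Module.finrank ℂ V using Nat.strong_induction_on generalizing V r with
  | _ n IH =>
  have ih : ∀ W : Submodule ℂ V, W ≠ ⊤ → ∀ r, NegIndexLE T W r → HasIsotropic T W r :=
    fun W hW r hr =>
      (IH _ (hn ▸ Submodule.finrank_lt hW) hr.compression rfl).of_compression
  by_cases h0 : n = 0
  · exact ⟨⊤, le_rfl, fun x _ y _ => by
      have := Module.finrank_zero_iff.1 (hn.trans h0)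
      rw [Subsingleton.elim x 0, inner_zero_left], by omega⟩
  by_cases hT : Function.Injective T
  · by_cases haniso : ∀ x ≠ 0, ∀ μ : ℂ, T x = μ • LinearMap.adjoint T x → inner ℂ x (T x) ≠ 0
    · obtain ⟨b, hev, hb⟩ := exists_orthogonal_eigenbasis hT haniso
      have : Nonempty (Fin (Module.finrank ℂ V)) := ⟨⟨0, by omega⟩⟩
      have hb0 : ∀ i, inner ℂ (b i) (T (b i)) ≠ 0 := fun i => by
        obtain ⟨μ, hμ⟩ := hev i
        exact haniso _ (b.ne_zero i) μ hμ
      refine HasIsotropic.of_orthogonal_basis ih h b hb hb0 ?_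
      intro i j t ht hz
      have hij : i ≠ j := by
        rintro rfl
        have h1 : ((1 + t : ℝ) : ℂ) * inner ℂ (b i) (T (b i)) = 0 := by
          push_cast
          linear_combination hz
        rcases mul_eq_zero.1 h1 with h2 | h2
        · have := Complex.ofReal_eq_zero.1 h2
          linarith
        · exact hb0 i h2
      obtain ⟨μ, hμ⟩ := hev i
      obtain ⟨ν, hν⟩ := hev j
      have hμz : ∀ k (κ : ℂ), T (b k) = κ • LinearMap.adjoint T (b k) →
          inner ℂ (b k) (T (b k)) = κ * (starRingEnd ℂ) (inner ℂ (b k) (T (b k))) := by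
        intro k κ hκ
        conv_lhs => rw [hκ]
        rw [inner_smul_right, LinearMap.adjoint_inner_right, inner_conj_symm]
      -- The relation z = κ z̄ determines κ from the real line through z, and opposite values span
      -- the same line.
      have hμν : ν = μ := by
        have h1 := hμz i μ hμ
        have h2 := hμz j ν hν
        rw [hz, map_mul, map_neg, Complex.conj_ofReal] at h2
        have h3 : (starRingEnd ℂ) (inner ℂ (b i) (T (b i))) ≠ 0 :=
          (map_ne_zero _).2 (hb0 i)
        have ht' : (t : ℂ) ≠ 0 := Complex.ofReal_ne_zero.2 ht.ne'
        refine mul_right_cancel₀ (mul_ne_zero ht' h3) ?_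
        linear_combination h2 + (t : ℂ) * h1
      subst hμν
      -- The form at this vector is t z_i + z_j = 0, giving an isotropic eigenvector.
      refine haniso (((√t : ℝ) : ℂ) • b i + b j) ?_ ν ?_ ?_
      · intro h1
        have := congrArg (fun v => b.repr v j) h1
        simp only [map_add, map_smul, Module.Basis.repr_self, map_zero, Finsupp.add_apply,
          Finsupp.smul_apply, Finsupp.single_eq_same, Finsupp.single_eq_of_ne hij.symm, smul_zero,
          zero_add, Finsupp.coe_zero, Pi.zero_apply] at this
        exact one_ne_zero this
      · rw [map_add, map_add, map_smul, map_smul, hμ, hν, smul_add, smul_comm]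
      · have ht2 : ((√t : ℝ) : ℂ) * ((√t : ℝ) : ℂ) = (t : ℂ) := by
          rw [← Complex.ofReal_mul, Real.mul_self_sqrt ht.le]
        simp only [map_add, map_smul, inner_add_left, inner_add_right, inner_smul_left,
          inner_smul_right, hb i j hij, hb j i hij.symm, Complex.conj_ofReal, hz]
        linear_combination (inner ℂ (b i) (T (b i))) * ht2
    · push Not at haniso
      obtain ⟨x, hx0, μ, hμ, hx⟩ := haniso
      exact HasIsotropic.of_isotropic_vector ih h hx0 hx (one_smul ℂ _).symm hμ
        (Or.inl one_ne_zero)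
  · obtain ⟨x, hx, hx0⟩ : ∃ x, T x = 0 ∧ x ≠ 0 := by
      by_contra! hcon
      exact hT (LinearMap.ker_eq_bot.1 (LinearMap.ker_eq_bot'.2 hcon))
    exact HasIsotropic.of_isotropic_vector ih h hx0 (by rw [hx, inner_zero_right])
      (one_smul ℂ _).symm (q := 0) (by rw [hx, zero_smul]) (Or.inl one_ne_zero)

/-! ### The rank-k numerical range as an intersection of numerical ranges -/

section Matrices

theorem star_dotProduct_eq_inner {m : ℕ} (x y : Fin m → ℂ) :
    star x ⬝ᵥ y = inner ℂ (WithLp.toLp 2 x) (WithLp.toLp 2 y) := by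
  rw [EuclideanSpace.inner_eq_star_dotProduct, dotProduct_comm]

theorem star_dotProduct_self_eq_one_iff {m : ℕ} (x : Fin m → ℂ) :
    star x ⬝ᵥ x = 1 ↔ ‖WithLp.toLp 2 x‖ = 1 := by
  rw [star_dotProduct_eq_inner, inner_self_eq_norm_sq_to_K]
  constructor
  · intro h
    have h1 : ‖WithLp.toLp 2 x‖ ^ 2 = 1 := Complex.ofReal_injective (by simpa using h)
    exact (pow_eq_one_iff_of_nonneg (norm_nonneg _) two_ne_zero).1 h1
  · intro h
    rw [h]
    simp

theorem isCompact_setOf_star_dotProduct_self_eq_one (m : ℕ) :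
    IsCompact {x : Fin m → ℂ | star x ⬝ᵥ x = 1} := by
  have h := (isCompact_sphere (0 : EuclideanSpace ℂ (Fin m)) 1).image
    (PiLp.continuous_ofLp 2 fun _ : Fin m => ℂ)
  convert h using 1
  ext x
  simp only [Set.mem_ofPred_eq, star_dotProduct_self_eq_one_iff, Set.mem_image,
    mem_sphere_zero_iff_norm]
  exact ⟨fun hx => ⟨WithLp.toLp 2 x, hx, rfl⟩, by rintro ⟨y, hy, rfl⟩; exact hy⟩

theorem isCompact_numRange {m : ℕ} (B : Matrix (Fin m) (Fin m) ℂ) : IsCompact (numRange B) := by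
  have hc : Continuous fun x : Fin m → ℂ => star x ⬝ᵥ (B *ᵥ x) := by fun_prop
  exact (isCompact_setOf_star_dotProduct_self_eq_one m).image hc

theorem mem_numRange_of_eq_mul {m : ℕ} {B : Matrix (Fin m) (Fin m) ℂ} {μ : ℂ} {v : Fin m → ℂ}
    (hv : v ≠ 0) (h : star v ⬝ᵥ (B *ᵥ v) = μ * (star v ⬝ᵥ v)) : μ ∈ numRange B := by
  have hn : 0 < ‖WithLp.toLp 2 v‖ := norm_pos_iff.2 (by simpa using hv)
  have hvv : star v ⬝ᵥ v = ((‖WithLp.toLp 2 v‖ ^ 2 : ℝ) : ℂ) := by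
    rw [star_dotProduct_eq_inner, inner_self_eq_norm_sq_to_K]
    simp
  set s := ‖WithLp.toLp 2 v‖ with hs
  have hs0 : (s : ℂ) ≠ 0 := Complex.ofReal_ne_zero.2 hn.ne'
  refine ⟨((s⁻¹ : ℝ) : ℂ) • v, ?_, ?_⟩
  · rw [star_smul, smul_dotProduct, dotProduct_smul, hvv]
    simp only [smul_eq_mul, Complex.star_def, Complex.conj_ofReal]
    push_cast
    field_simp
  · rw [Matrix.mulVec_smul, star_smul, smul_dotProduct, dotProduct_smul, h, hvv]
    simp only [smul_eq_mul, Complex.star_def, Complex.conj_ofReal]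
    push_cast
    field_simp

theorem star_dotProduct_conjTranspose_mul_mul_mulVec {n m : ℕ} (A : Matrix (Fin n) (Fin n) ℂ)
    (M : Matrix (Fin n) (Fin m) ℂ) (x : Fin m → ℂ) :
    star x ⬝ᵥ ((Mᴴ * A * M) *ᵥ x) = star (M *ᵥ x) ⬝ᵥ (A *ᵥ (M *ᵥ x)) := by
  rw [Matrix.star_mulVec, ← Matrix.dotProduct_mulVec, Matrix.mulVec_mulVec, Matrix.mulVec_mulVec,
    Matrix.mul_assoc]

theorem star_mulVec_dotProduct_mulVec_of_mem_isometries {n m : ℕ} {M : Matrix (Fin n) (Fin m) ℂ}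
    (hM : M ∈ isometries n m) (x : Fin m → ℂ) : star (M *ᵥ x) ⬝ᵥ (M *ᵥ x) = star x ⬝ᵥ x := by
  have h := star_dotProduct_conjTranspose_mul_mul_mulVec 1 M x
  rw [Matrix.mul_one, show Mᴴ * M = 1 from hM, Matrix.one_mulVec, Matrix.one_mulVec] at h
  exact h.symm

/-- The ranges of X and M have dimensions k and m with k + m > n, so they share a nonzero vector, on
which A has Rayleigh quotient μ. -/
theorem rankNumRange_subset_numRange {n k m : ℕ} (hkm : n < k + m) (A : Matrix (Fin n) (Fin n) ℂ)
    {M : Matrix (Fin n) (Fin m) ℂ} (hM : M ∈ isometries n m) :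
    rankNumRange k A ⊆ numRange (Mᴴ * A * M) := by
  rintro μ ⟨X, hX, hXA⟩
  let f : ((Fin k → ℂ) × (Fin m → ℂ)) →ₗ[ℂ] (Fin n → ℂ) :=
    X.mulVecLin.coprod (-M.mulVecLin)
  have hf : LinearMap.ker f ≠ ⊥ := LinearMap.ker_ne_bot_of_finrank_lt (by simpa using hkm)
  obtain ⟨⟨u, v⟩, huv, h0⟩ := Submodule.exists_mem_ne_zero_of_ne_bot hf
  have huv' : X *ᵥ u = M *ᵥ v := by
    have : X *ᵥ u + -(M *ᵥ v) = 0 := by simpa [f] using huv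
    exact add_neg_eq_zero.1 this
  have hv : v ≠ 0 := by
    rintro rfl
    apply h0
    have : u = Xᴴ *ᵥ (X *ᵥ u) := by
      rw [Matrix.mulVec_mulVec, show Xᴴ * X = 1 from hX, Matrix.one_mulVec]
    rw [this, huv', Matrix.mulVec_zero, Matrix.mulVec_zero]
    rfl
  refine mem_numRange_of_eq_mul hv ?_
  rw [star_dotProduct_conjTranspose_mul_mul_mulVec, ← huv',
    ← star_dotProduct_conjTranspose_mul_mul_mulVec, hXA, Matrix.smul_mulVec, Matrix.one_mulVec,
    dotProduct_smul, ← star_mulVec_dotProduct_mulVec_of_mem_isometries hX,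
    ← star_mulVec_dotProduct_mulVec_of_mem_isometries hM v, huv', smul_eq_mul]

theorem Submodule.exists_orthonormal_of_le_finrank {V : Type*} [NormedAddCommGroup V]
    [InnerProductSpace ℂ V] [FiniteDimensional ℂ V] {U : Submodule ℂ V} {m : ℕ}
    (h : m ≤ Module.finrank ℂ U) : ∃ v : Fin m → V, Orthonormal ℂ v ∧ ∀ i, v i ∈ U := by
  have h1 := ((stdOrthonormalBasis ℂ U).orthonormal.comp_linearIsometry U.subtypeₗᵢ).comp
    (Fin.castLE h) (Fin.castLE_injective h)
  exact ⟨_, h1, fun i => Subtype.coe_prop _⟩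

/-- The matrix with the given columns. -/
def columnMatrix {n m : ℕ} (v : Fin m → EuclideanSpace ℂ (Fin n)) : Matrix (Fin n) (Fin m) ℂ :=
  Matrix.of fun i j => v j i

theorem toLp_columnMatrix_mulVec {n m : ℕ} (v : Fin m → EuclideanSpace ℂ (Fin n))
    (x : Fin m → ℂ) : WithLp.toLp 2 (columnMatrix v *ᵥ x) = ∑ j, x j • v j := by
  ext i
  simp [columnMatrix, Matrix.mulVec, dotProduct, mul_comm]

theorem conjTranspose_columnMatrix_mul_mul_apply {n m : ℕ}
    (v : Fin m → EuclideanSpace ℂ (Fin n)) (B : Matrix (Fin n) (Fin n) ℂ) (i j : Fin m) :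
    ((columnMatrix v)ᴴ * B * columnMatrix v) i j =
      inner ℂ (v i) (Matrix.toEuclideanLin B (v j)) := by
  rw [EuclideanSpace.inner_eq_star_dotProduct, dotProduct_comm, Matrix.mul_assoc]
  rfl

theorem columnMatrix_mem_isometries {n m : ℕ} {v : Fin m → EuclideanSpace ℂ (Fin n)}
    (hv : Orthonormal ℂ v) : columnMatrix v ∈ isometries n m := by
  show (columnMatrix v)ᴴ * columnMatrix v = 1
  ext i j
  have h := conjTranspose_columnMatrix_mul_mul_apply v 1 i j
  rw [Matrix.mul_one] at h
  rw [h, Matrix.one_apply]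
  have h1 : Matrix.toEuclideanLin (1 : Matrix (Fin n) (Fin n) ℂ) (v j) = v j := by
    ext a
    simp
  rw [h1]
  exact orthonormal_iff_ite.1 hv i j

theorem mem_rankNumRange_of_forall_mem_numRange {n k : ℕ} (hkn : k ≤ n)
    {A : Matrix (Fin n) (Fin n) ℂ} {μ : ℂ}
    (h : ∀ M ∈ isometries n (n - k + 1), μ ∈ numRange (Mᴴ * A * M)) : μ ∈ rankNumRange k A := by
  set T := Matrix.toEuclideanLin (A - μ • (1 : Matrix (Fin n) (Fin n) ℂ)) with hT
  have hneg : NegIndexLE T ⊤ (n - k) := by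
    intro c hc U _ hU
    by_contra hcon
    -- An isometry M with columns in U would put into U a unit vector y with ⟪y, Ty⟫ = 0.
    obtain ⟨v, hv, hvU⟩ := Submodule.exists_orthonormal_of_le_finrank
      (show n - k + 1 ≤ Module.finrank ℂ U by omega)
    have hM := columnMatrix_mem_isometries hv
    obtain ⟨x, hx1, hx⟩ := h _ hM
    rw [star_dotProduct_conjTranspose_mul_mul_mulVec] at hx
    rw [← star_mulVec_dotProduct_mulVec_of_mem_isometries hM] at hx1
    set y := columnMatrix v *ᵥ x with hy
    have hyU : WithLp.toLp 2 y ∈ U := by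
      rw [hy, toLp_columnMatrix_mulVec]
      exact Submodule.sum_mem _ fun j _ => Submodule.smul_mem _ _ (hvU j)
    have hy0 : WithLp.toLp 2 y ≠ 0 := by
      intro h0
      rw [star_dotProduct_self_eq_one_iff, h0, norm_zero] at hx1
      norm_num at hx1
    have h1 := hU _ hyU hy0
    have h2 : inner ℂ (WithLp.toLp 2 y) (T (WithLp.toLp 2 y)) = 0 := by
      have h3 : T (WithLp.toLp 2 y) = WithLp.toLp 2 ((A - μ • 1) *ᵥ y) := rfl
      rw [h3, ← star_dotProduct_eq_inner, Matrix.sub_mulVec, dotProduct_sub, hx,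
        Matrix.smul_mulVec, Matrix.one_mulVec, dotProduct_smul, hx1, smul_eq_mul, mul_one, sub_self]
    rw [LinearMap.smul_apply, inner_smul_right, h2, mul_zero] at h1
    simp at h1
  obtain ⟨L, _, hL, hLr⟩ := hneg.hasIsotropic
  rw [finrank_top, finrank_euclideanSpace_fin] at hLr
  obtain ⟨v, hv, hvL⟩ := Submodule.exists_orthonormal_of_le_finrank
    (show k ≤ Module.finrank ℂ L by omega)
  have hX := columnMatrix_mem_isometries hv
  refine ⟨columnMatrix v, hX, ?_⟩
  have h1 : (columnMatrix v)ᴴ * (A - μ • 1) * columnMatrix v = 0 := by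
    ext i j
    rw [conjTranspose_columnMatrix_mul_mul_apply]
    exact hL _ (hvL i) _ (hvL j)
  rw [Matrix.mul_sub, Matrix.sub_mul, Matrix.mul_smul, Matrix.smul_mul, Matrix.mul_one,
    show (columnMatrix v)ᴴ * columnMatrix v = 1 from hX] at h1
  exact sub_eq_zero.1 h1

/-- The set is the projection of a closed set along the compact unit sphere. -/
theorem isClosed_setOf_mem_numRange {n m : ℕ} (A : Matrix (Fin n) (Fin n) ℂ) (μ : ℂ) :
    IsClosed {M : isometries n m | μ ∈ numRange ((M : Matrix (Fin n) (Fin m) ℂ)ᴴ * A *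
      (M : Matrix (Fin n) (Fin m) ℂ))} := by
  let K := {x : Fin m → ℂ | star x ⬝ᵥ x = 1}
  have : CompactSpace K :=
    isCompact_iff_compactSpace.1 (isCompact_setOf_star_dotProduct_self_eq_one m)
  have hc : Continuous fun z : isometries n m × K =>
      star (z.2 : Fin m → ℂ) ⬝ᵥ
        (((z.1 : Matrix (Fin n) (Fin m) ℂ)ᴴ * A * (z.1 : Matrix (Fin n) (Fin m) ℂ)) *ᵥ
          (z.2 : Fin m → ℂ)) := by
    have h1 : Continuous fun z : isometries n m × K => (z.1 : Matrix (Fin n) (Fin m) ℂ) := by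
      fun_prop
    have h2 : Continuous fun z : isometries n m × K => (z.2 : Fin m → ℂ) := by
      fun_prop
    exact h2.star.dotProduct
      (((h1.matrix_conjTranspose.matrix_mul continuous_const).matrix_mul h1).matrix_mulVec h2)
  convert isClosedMap_fst_of_compactSpace _ (isClosed_singleton.preimage hc (t := {μ})) using 1
  ext M
  simp only [Set.mem_ofPred_eq, Set.mem_image, Set.mem_preimage, Set.mem_singleton_iff]
  constructor
  · rintro ⟨x, hx, h⟩
    exact ⟨(M, ⟨x, hx⟩), h, rfl⟩
  · rintro ⟨⟨M', ⟨x, hx⟩⟩, h, rfl⟩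
    exact ⟨x, hx, h⟩

theorem rankNumRange_eq_iInter_of_denseRange {n k : ℕ} (hkn : k ≤ n)
    {M : ℕ → isometries n (n - k + 1)} (hM : DenseRange M) (A : Matrix (Fin n) (Fin n) ℂ) :
    rankNumRange k A = ⋂ p : ℕ, numRange ((M p : Matrix (Fin n) (Fin (n - k + 1)) ℂ)ᴴ * A *
      (M p : Matrix (Fin n) (Fin (n - k + 1)) ℂ)) := by
  apply Set.Subset.antisymm
  · exact Set.subset_iInter fun p => rankNumRange_subset_numRange (by omega) A (M p).2
  · intro μ hμ
    refine mem_rankNumRange_of_forall_mem_numRange hkn fun N hN => ?_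
    exact hM.induction_on (p := fun N => μ ∈ numRange
      ((N : Matrix (Fin n) (Fin (n - k + 1)) ℂ)ᴴ * A * (N : Matrix (Fin n) (Fin (n - k + 1)) ℂ)))
      ⟨N, hN⟩ (isClosed_setOf_mem_numRange A μ) (Set.mem_iInter.1 hμ)

theorem exists_denseRange_isometries {n m : ℕ} (hmn : m ≤ n) :
    ∃ M : ℕ → isometries n m, DenseRange M := by
  have : Nonempty (isometries n m) := by
    obtain ⟨v, hv, _⟩ := Submodule.exists_orthonormal_of_le_finrank
      (U := (⊤ : Submodule ℂ (EuclideanSpace ℂ (Fin n)))) (m := m) (by simpa using hmn)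
    exact ⟨⟨_, columnMatrix_mem_isometries hv⟩⟩
  have : SecondCountableTopology (Matrix (Fin n) (Fin m) ℂ) :=
    inferInstanceAs (SecondCountableTopology (Fin n → Fin m → ℂ))
  exact TopologicalSpace.exists_dense_seq _

end Matrices

/-! ### Least modulus and compactness -/

section InfModulus

theorem infModulus_anti {S S' : Set ℂ} (h : S ⊆ S') : infModulus S' ≤ infModulus S :=
  biInf_mono h

theorem infModulus_le {S : Set ℂ} {z : ℂ} (hz : z ∈ S) : infModulus S ≤ ‖z‖ₑ :=
  iInf₂_le z hz

/-- A minimiser z ≠ 0 cannot be interior, as t z with t < 1 close to 1 would be a smaller point of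
S. -/
theorem IsCompact.exists_mem_frontier_enorm_eq_infModulus {S : Set ℂ} (hS : IsCompact S)
    (hne : S.Nonempty) (h0 : (0 : ℂ) ∉ S) : ∃ z ∈ frontier S, ‖z‖ₑ = infModulus S := by
  obtain ⟨z, hzS, hz⟩ := hS.exists_isMinOn hne continuous_norm.continuousOn
  have hmin : ∀ w ∈ S, ‖z‖ ≤ ‖w‖ := fun w hw => hz hw
  refine ⟨z, ?_, le_antisymm (le_iInf₂ fun w hw => ?_) (infModulus_le hzS)⟩
  · rw [hS.isClosed.frontier_eq]
    refine ⟨hzS, fun hint => ?_⟩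
    have hz0 : 0 < ‖z‖ := norm_pos_iff.2 fun h => h0 (h ▸ hzS)
    have hc : Continuous fun t : ℝ => (t : ℂ) * z := by fun_prop
    have h1 : ∀ᶠ t : ℝ in nhds 1, (t : ℂ) * z ∈ S :=
      hc.continuousAt.eventually_mem (by simpa using mem_interior_iff_mem_nhds.1 hint)
    have h2 : ∀ᶠ t : ℝ in nhdsWithin 1 (Set.Iio 1), t ∈ Set.Ioo (0 : ℝ) 1 :=
      Ioo_mem_nhdsLT one_pos
    obtain ⟨t, ht, ht0, ht1⟩ := ((h1.filter_mono nhdsWithin_le_nhds).and h2).exists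
    have h3 := hmin _ ht
    rw [norm_mul, Complex.norm_real, Real.norm_of_nonneg ht0.le] at h3
    nlinarith
  · exact enorm_le_iff_norm_le.2 (hmin w hw)

theorem IsCompact.infModulus_frontier {S : Set ℂ} (hS : IsCompact S) (h0 : (0 : ℂ) ∉ S) :
    infModulus (frontier S) = infModulus S := by
  refine le_antisymm ?_ (infModulus_anti hS.isClosed.frontier_subset)
  rcases S.eq_empty_or_nonempty with rfl | hne
  · rw [frontier_empty]
  · obtain ⟨z, hz, h⟩ := hS.exists_mem_frontier_enorm_eq_infModulus hne h0
    exact h ▸ infModulus_le hz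

/-- Cantor's intersection theorem: if every J ν met the ball of radius s, so would the intersection.
An empty intersection, with value ∞, needs no separate treatment. -/
theorem infModulus_iInter_eq_iSup {J : ℕ → Set ℂ} (hJ : Antitone J) (hc : ∀ ν, IsCompact (J ν)) :
    infModulus (⋂ ν, J ν) = ⨆ ν, infModulus (J ν) := by
  refine le_antisymm ?_ (iSup_le fun ν => infModulus_anti (Set.iInter_subset J ν))
  refine le_of_forall_lt_imp_le_of_dense fun s hs => ?_
  have hclosed : IsClosed {z : ℂ | ‖z‖ₑ ≤ s} := isClosed_le continuous_enorm continuous_const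
  obtain ⟨ν, hν⟩ : ∃ ν, ¬ (J ν ∩ {z : ℂ | ‖z‖ₑ ≤ s}).Nonempty := by
    by_contra! hcon
    obtain ⟨z, hz⟩ := IsCompact.nonempty_iInter_of_directed_nonempty_isCompact_isClosed
      (fun ν => J ν ∩ {z : ℂ | ‖z‖ₑ ≤ s})
      (Antitone.directed_ge fun a b hab => Set.inter_subset_inter_left _ (hJ hab))
      hcon (fun ν => (hc ν).inter_right hclosed) (fun ν => (hc ν).isClosed.inter hclosed)
    have hz' := Set.mem_iInter.1 hz
    have h1 : infModulus (⋂ ν, J ν) ≤ ‖z‖ₑ := infModulus_le (Set.mem_iInter.2 fun ν => (hz' ν).1)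
    exact absurd (h1.trans (hz' 0).2) (not_le.2 hs)
  have h1 : s ≤ infModulus (J ν) := le_iInf₂ fun z hz => ?_
  · exact h1.trans (le_iSup (fun ν => infModulus (J ν)) ν)
  by_contra hcon
  exact hν ⟨z, hz, (not_le.1 hcon).le⟩

end InfModulus

/-! ### The sets 𝒥_ν and the conclusion -/

section InterRange

variable {n m : ℕ} (M : ℕ → isometries n m) (A : Matrix (Fin n) (Fin n) ℂ)

theorem interRange_antitone : Antitone (interRange M A) := by
  intro a b hab
  exact Set.biInter_mono (fun p (hp : p ≤ a) => hp.trans hab) fun _ _ => le_rfl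

theorem isCompact_interRange (ν : ℕ) : IsCompact (interRange M A ν) :=
  (isCompact_numRange _).of_isClosed_subset
    (isClosed_biInter fun _ _ => (isCompact_numRange _).isClosed)
    (Set.biInter_subset_of_mem (Nat.zero_le ν))

theorem iInter_interRange : ⋂ ν, interRange M A ν =
    ⋂ p : ℕ, numRange ((M p : Matrix (Fin n) (Fin m) ℂ)ᴴ * A * (M p : Matrix (Fin n) (Fin m) ℂ)) :=
  Set.Subset.antisymm
    (Set.subset_iInter fun p => (Set.iInter_subset _ p).trans (Set.biInter_subset_of_mem (le_refl p)))
    (Set.subset_iInter fun _ => Set.subset_iInter₂ fun p _ => Set.iInter_subset _ p)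

end InterRange

theorem theorem3p2 (n k : ℕ) (hk : 1 ≤ k) (hkn : k ≤ n) :
    (∃ M : ℕ → isometries n (n - k + 1), DenseRange M) ∧
    ∀ (M : ℕ → isometries n (n - k + 1)) (A : Matrix (Fin n) (Fin n) ℂ),
      (DenseRange M ∨
        rankNumRange k A =
          ⋂ p : ℕ, numRange ((M p : Matrix (Fin n) (Fin (n - k + 1)) ℂ)ᴴ * A *
            (M p : Matrix (Fin n) (Fin (n - k + 1)) ℂ))) →
      (0 : ℂ) ∉ rankNumRange k A →
        ((rankNumRange k A).Nonempty →
          ∃ z ∈ frontier (rankNumRange k A), ‖z‖ₑ = innerRankRadius k A) ∧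
        Filter.Tendsto (fun ν : ℕ => infModulus (interRange M A ν)) Filter.atTop
          (nhds (innerRankRadius k A)) ∧
        innerRankRadius k A = ⨆ ν : ℕ, infModulus (interRange M A ν) := by
  refine ⟨exists_denseRange_isometries (by omega), fun M A hMA h0 => ?_⟩
  have hΛ : rankNumRange k A = ⋂ ν, interRange M A ν := by
    rw [iInter_interRange]
    exact hMA.elim (fun hM => rankNumRange_eq_iInter_of_denseRange hkn hM A) id
  have hcompact : IsCompact (rankNumRange k A) := by
    rw [hΛ]
    exact (isCompact_interRange M A 0).of_isClosed_subset
      (isClosed_iInter fun ν => (isCompact_interRange M A ν).isClosed) (Set.iInter_subset _ 0)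
  have hradius : innerRankRadius k A = infModulus (rankNumRange k A) :=
    hcompact.infModulus_frontier h0
  have hsup : innerRankRadius k A = ⨆ ν : ℕ, infModulus (interRange M A ν) := by
    rw [hradius, hΛ]
    exact infModulus_iInter_eq_iSup (interRange_antitone M A) (isCompact_interRange M A)
  refine ⟨fun hne => ?_, ?_, hsup⟩
  · rw [hradius]
    exact hcompact.exists_mem_frontier_enorm_eq_infModulus hne h0
  · rw [hsup]
    exact tendsto_atTop_iSup fun a b hab => infModulus_anti (interRange_antitone M A hab)
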